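/- Let $L$ be a positive-definite, even lattice with form $\langle\cdot,\cdot\rangle$, let $\mathfrak{h}=L\otimes_{\mathbb Z}\mathbb C$, and let $V_L=M_{\hat{\mathfrak h}}(1)\otimes\mathbb C_\varepsilon[L]$ be the associated lattice vertex operator algebra, where $\varepsilon\colon L\times L\to\{\pm1\}$ is a group $2$-cocycle with $\varepsilon(\alpha,\beta)/\varepsilon(\beta,\alpha)=(-1)^{\langle\alpha,\beta\rangle}$. Let $L'=\{x\in L\otimes_{\mathbb Z}\mathbb Q : \langle x,\beta\rangle\in\mathbb Z\text{ for all }\beta\in L\}$ be the dual lattice. Let $\nu\in O(L)$ have order $m$; write $\mathfrak h^\nu$ and $(L')^\nu$ for the elements of $\mathfrak h$ and $L'$ fixed by $\nu$. Let $\hat\nu\in\operatorname{Aut}(V_L)$ be a standard lift of $\nu$, i.e. $\hat\nu$ acts on $M_{\hat{\mathfrak h}}(1)$ as $\nu$ and on $\mathbb C_\varepsilon[L]$ by $\mathfrak e_\alpha\mapsto\eta(\alpha)\mathfrak e_{\nu\alpha}$, where $\eta\colon L\to\{\pm1\}$ satisfies $\eta(\alpha)\eta(\beta)/\eta(\alpha+\beta)=\varepsilon(\alpha,\beta)/\varepsilon(\nu\alpha,\nu\beta)$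 for all $\alpha,\beta\in L$ and $\eta(\alpha)=1$ whenever $\nu\alpha=\alpha$. For $h\in\mathfrak h$ let $e^{-2\pi i h(0)}\in\operatorname{Aut}(V_L)$ be the automorphism acting on $M_{\hat{\mathfrak h}}(1)\otimes\mathfrak e_\alpha$ as multiplication by $e^{-2\pi i\langle h,\alpha\rangle}$. Then $\hat\nu$ has order $m$ or $2m$, and the following hold. (1) If $\hat\nu$ has order $m$, then for all $h\in\mathfrak h^\nu$ the automorphism $\hat\nu e^{-2\pi i h(0)}$ has order $m$ if and only if $h\in\frac1m(L')^\nu$. (2) If $\hat\nu$ has order $2m$ (order doubling), then there is $s\in\frac1{2m}(L')^\nu$ such that $e^{-2\pi i s(0)}$ has order $2m$ and $\hat\nu e^{-2\pi i s(0)}$ has order $m$. Moreover, for every $s\in\frac1{2m}(L')^\nu$ such that $\hat\nu e^{-2\pi i s(0)}$ has order $m$, and all $h\in\mathfrak h^\nu$, the automorphism $\hat\nu e^{-2\pi i h(0)}$ has order $m$ if and only if $h\in s+\frac1m(L')^\nu$. -/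

import Mathlib

open scoped TensorProduct Pointwise

namespace LatticeVOA

noncomputable section

/-! ### Lattices, isometries and dual lattices -/

/-- The Cartan algebra `𝔥 = L ⊗_ℤ ℂ`. -/
abbrev Cartan (L : Type*) [AddCommGroup L] : Type _ := ℂ ⊗[ℤ] L

/-- The isometry group `O(L)` of the lattice `L` with bilinear form `B`. -/
def isometryGroup {L : Type*} [AddCommGroup L] (B : LinearMap.BilinForm ℤ L) :
    Subgroup (L ≃ₗ[ℤ] L) where
  carrier := {ν | ∀ α β, B (ν α) (ν β) = B α β}
  mul_mem' {μ ν} hμ hν α β := by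
    simp only [Set.mem_ofPred_eq] at hμ hν
    simp [LinearEquiv.mul_apply, hμ, hν]
  one_mem' α β := rfl
  inv_mem' {ν} hν α β := by
    simp only [Set.mem_ofPred_eq] at hν
    rw [← hν]
    simp

/-- The complex bilinear extension of the form of `L` to `𝔥`. -/
abbrev formC {L : Type*} [AddCommGroup L] (B : LinearMap.BilinForm ℤ L) :
    LinearMap.BilinForm ℂ (Cartan L) := B.baseChange ℂ

/-- The embedding `L → 𝔥`. -/
def toCartan {L : Type*} [AddCommGroup L] (α : L) : Cartan L := (1 : ℂ) ⊗ₜ[ℤ] α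

/-- The complex linear extension of `ν` to `𝔥`. -/
def extC {L : Type*} [AddCommGroup L] (ν : L ≃ₗ[ℤ] L) : Cartan L →ₗ[ℂ] Cartan L :=
  (ν : L →ₗ[ℤ] L).baseChange ℂ

/-- The subspace `𝔥^ν` of fixed points of `ν` in `𝔥`. -/
def fixedCartan {L : Type*} [AddCommGroup L] (ν : L ≃ₗ[ℤ] L) : Submodule ℂ (Cartan L) :=
  LinearMap.eqLocus (extC ν) LinearMap.id

/-- The dual lattice `L' = {x ∈ L ⊗_ℤ ℚ : ⟨x, β⟩ ∈ ℤ for all β ∈ L}`. -/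
def dualLattice {L : Type*} [AddCommGroup L] (B : LinearMap.BilinForm ℤ L) :
    AddSubgroup (ℚ ⊗[ℤ] L) where
  carrier := {x | ∀ β : L, ∃ k : ℤ, B.baseChange ℚ x ((1 : ℚ) ⊗ₜ[ℤ] β) = k}
  zero_mem' β := ⟨0, by simp⟩
  add_mem' {x y} hx hy β := by
    obtain ⟨k, hk⟩ := hx β
    obtain ⟨l, hl⟩ := hy β
    exact ⟨k + l, by rw [map_add, LinearMap.add_apply, hk, hl]; push_cast; rfl⟩
  neg_mem' {x} hx β := by
    obtain ⟨k, hk⟩ := hx β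
    exact ⟨-k, by rw [map_neg, LinearMap.neg_apply, hk]; push_cast; rfl⟩

/-- The natural map `L ⊗_ℤ ℚ → L ⊗_ℤ ℂ = 𝔥`. -/
def ratToCartan (L : Type*) [AddCommGroup L] : ℚ ⊗[ℤ] L →ₗ[ℤ] Cartan L :=
  LinearMap.rTensor L (algebraMap ℚ ℂ).toIntAlgHom.toLinearMap

/-- The group `(L')^ν` of the elements of the dual lattice that are fixed by `ν`,
as a subset of `𝔥`. -/
def dualFixed {L : Type*} [AddCommGroup L] (B : LinearMap.BilinForm ℤ L) (ν : L ≃ₗ[ℤ] L) :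
    Set (Cartan L) :=
  ratToCartan L '' {x | x ∈ dualLattice B ∧ (ν : L →ₗ[ℤ] L).baseChange ℚ x = x}

/-- `ε : L × L → {±1}` is a group 2-cocycle with
`ε(α, β) / ε(β, α) = (-1) ^ ⟨α, β⟩`. -/
structure IsLatticeCocycle {L : Type*} [AddCommGroup L] (B : LinearMap.BilinForm ℤ L)
    (ε : L → L → ℤˣ) : Prop where
  cocycle : ∀ α β γ, ε α β * ε (α + β) γ = ε β γ * ε α (β + γ)
  comm : ∀ α β, ε α β / ε β α = (-1) ^ (B α β)

/-! ### The space `V_L` -/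

/-- The Fock space `M(1) = Sym(𝔥 ⊗ t⁻¹ℂ[t⁻¹])`; the basis vector with index `n` of `ℕ →₀ 𝔥`
stands for `t^(-n-1)`. -/
abbrev Fock (L : Type*) [AddCommGroup L] : Type _ := SymmetricAlgebra ℂ (ℕ →₀ Cartan L)

/-- The element `h(-n-1)` of the Fock space. -/
def osc {L : Type*} [AddCommGroup L] (n : ℕ) (h : Cartan L) : Fock L :=
  SymmetricAlgebra.ι ℂ _ (Finsupp.single n h)

lemma osc_add {L : Type*} [AddCommGroup L] (n : ℕ) (h k : Cartan L) :
    osc n (h + k) = osc n h + osc n k := by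
  simp [osc]

lemma osc_smul {L : Type*} [AddCommGroup L] (n : ℕ) (a : ℂ) (h : Cartan L) :
    osc n (a • h) = a • osc n h := by
  rw [osc, ← Finsupp.smul_single, map_smul, osc]

/-- The space `V_L = M(1) ⊗ ℂ_ε[L] = ⨁_{α ∈ L} M(1) ⊗ 𝔢_α`; the vector `u ⊗ 𝔢_α` is
`Finsupp.single α u`. -/
abbrev Space (L : Type*) [AddCommGroup L] : Type _ := L →₀ Fock L

/-- The vacuum vector `1 ⊗ 1`, where `1 = ε(0,0)⁻¹ 𝔢_0` is the identity of the twisted group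
algebra `ℂ_ε[L]`, whose product is `𝔢_α 𝔢_β = ε(α,β) 𝔢_{α+β}`; it is `1 ⊗ 𝔢_0` if `ε` is
normalised. -/
def vacuum {L : Type*} [AddCommGroup L] (ε : L → L → ℤˣ) : Space L :=
  Finsupp.single 0 (((ε 0 0 : ℤˣ) : ℤ) : Fock L)

open Classical in
/-- The conformal vector `½ ∑ᵢⱼ (G⁻¹)ᵢⱼ bᵢ(-1) bⱼ(-1) 𝟏`, where `b` is a `ℤ`-basis of `L` with
Gram matrix `G`. -/
def conformal {L : Type*} [AddCommGroup L] [Module.Free ℤ L] [Module.Finite ℤ L]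
    (B : LinearMap.BilinForm ℤ L) (ε : L → L → ℤˣ) : Space L :=
  let b := Module.Free.chooseBasis ℤ L
  let G : Matrix (Module.Free.ChooseBasisIndex ℤ L) (Module.Free.ChooseBasisIndex ℤ L) ℂ :=
    Matrix.of fun i j => ((B (b i) (b j) : ℤ) : ℂ)
  (1 / 2 : ℂ) • ∑ i, ∑ j, G⁻¹ i j •
    ((osc 0 (toCartan (b i)) * osc 0 (toCartan (b j))) • vacuum ε)

/-! ### Vertex operators -/

/-- A linear map from `M` to an algebra with pairwise commuting values extends to the symmetric
algebra of `M`. -/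
def symLift {M A : Type*} [AddCommGroup M] [Module ℂ M] [Semiring A] [Algebra ℂ A]
    (f : M →ₗ[ℂ] A) (hf : ∀ x y, Commute (f x) (f y)) : SymmetricAlgebra ℂ M →ₐ[ℂ] A :=
  RingCon.liftₐ (TensorAlgebra.symRingCon ℂ M) (TensorAlgebra.lift ℂ f) (by
    refine fun x y h => RingCon.ringConGen_le.2 (fun x y h' => ?_) h
    induction h' with | mul_comm x y
    rw [RingCon.ker_apply, map_mul, map_mul]
    simpa using (hf x y).eq)

lemma symLift_ι {M A : Type*} [AddCommGroup M] [Module ℂ M] [Semiring A] [Algebra ℂ A]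
    (f : M →ₗ[ℂ] A) (hf : ∀ x y, Commute (f x) (f y)) (x : M) :
    symLift f hf (SymmetricAlgebra.ι ℂ M x) = f x := by
  simp [symLift, SymmetricAlgebra.ι]

lemma smul_eq_C_mul {L : Type*} [AddCommGroup L] (a : ℂ) (x : LaurentSeries (Fock L)) :
    a • x = HahnSeries.C (algebraMap ℂ (Fock L) a) * x := by
  rw [HahnSeries.C_mul_eq_smul]
  ext n
  simp [Algebra.smul_def]

/-- Multiplication by a Laurent series, as a `ℂ`-linear map. -/
def mulK {L : Type*} [AddCommGroup L] (c : LaurentSeries (Fock L)) :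
    LaurentSeries (Fock L) →ₗ[ℂ] LaurentSeries (Fock L) where
  toFun x := c * x
  map_add' := mul_add c
  map_smul' a x := by
    simp only [RingHom.id_apply, smul_eq_C_mul]
    ring

/-- The `ℂ`-linear maps `M(1) → M(1)((z))`. -/
abbrev FockField (L : Type*) [AddCommGroup L] : Type _ :=
  Fock L →ₗ[ℂ] LaurentSeries (Fock L)

/-- The positive modes of `h`: the homomorphism `w ↦ w + ∑_{k ≥ 1} (h(k) w) X^k` to a trivial
square-zero extension. It encodes that `h(k)` is the derivation of `M(1)` with
`h(k) h'(-m) = k ⟨h, h'⟩ δ_{k,m}`. -/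
def annihHom {L : Type*} [AddCommGroup L] (B : LinearMap.BilinForm ℤ L) (h : Cartan L) :
    Fock L →ₐ[ℂ] TrivSqZeroExt (Fock L) (Polynomial (Fock L)) :=
  SymmetricAlgebra.lift
    ((TrivSqZeroExt.inlAlgHom ℂ (Fock L) (Polynomial (Fock L))).toLinearMap ∘ₗ
        SymmetricAlgebra.ι ℂ (ℕ →₀ Cartan L) +
      (TrivSqZeroExt.inrHom (Fock L) (Polynomial (Fock L))).restrictScalars ℂ ∘ₗ
        Finsupp.lsum ℂ fun n : ℕ => ((n : ℂ) + 1) •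
          ((Polynomial.monomial (R := Fock L) (n + 1)).restrictScalars ℂ ∘ₗ
            Algebra.linearMap ℂ (Fock L) ∘ₗ formC B h))

/-- `annih B h w = ∑_{k ≥ 1} (h(k) w) X^k`. -/
def annih {L : Type*} [AddCommGroup L] (B : LinearMap.BilinForm ℤ L) (h : Cartan L) :
    Fock L →ₗ[ℂ] Polynomial (Fock L) :=
  (TrivSqZeroExt.sndHom (Fock L) (Polynomial (Fock L))).restrictScalars ℂ ∘ₗ
    (annihHom B h).toLinearMap

lemma annih_ι {L : Type*} [AddCommGroup L] (B : LinearMap.BilinForm ℤ L) (h : Cartan L)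
    (n : ℕ) (k : Cartan L) :
    annih B h (osc n k) = Polynomial.monomial (n + 1)
      (algebraMap ℂ (Fock L) (((n : ℂ) + 1) * formC B h k)) := by
  simp only [annih, annihHom, osc]
  simp [-Polynomial.monomial_mul_C, Algebra.smul_def,
    ← Polynomial.C_mul_monomial]

lemma annih_mul {L : Type*} [AddCommGroup L] (B : LinearMap.BilinForm ℤ L) (h : Cartan L)
    (v w : Fock L) : annih B h (v * w) = v • annih B h w + w • annih B h v := by
  have key : ∀ u : Fock L, (annihHom B h u).fst = u := fun u => by
    have : (TrivSqZeroExt.fstHom ℂ (Fock L) (Polynomial (Fock L))).comp (annihHom B h) =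
        AlgHom.id ℂ (Fock L) := by
      apply SymmetricAlgebra.algHom_ext
      ext
      simp [annihHom]
    exact congrArg (fun f => f u) this
  simp [annih, key]

lemma annih_algebraMap {L : Type*} [AddCommGroup L] (B : LinearMap.BilinForm ℤ L)
    (h : Cartan L) (a : ℂ) : annih B h (algebraMap ℂ (Fock L) a) = 0 := by
  simp [annih, TrivSqZeroExt.algebraMap_eq_inl']

@[elab_as_elim]
lemma fock_induction {L : Type*} [AddCommGroup L] {P : Fock L → Prop}
    (hC : ∀ a, P (algebraMap ℂ (Fock L) a)) (hosc : ∀ n h, P (osc n h))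
    (hmul : ∀ v w, P v → P w → P (v * w)) (hadd : ∀ v w, P v → P w → P (v + w))
    (w : Fock L) : P w := by
  induction w using SymmetricAlgebra.induction with
  | algebraMap a => exact hC a
  | ι x =>
    induction x using Finsupp.induction_linear with
    | zero => simpa using hC 0
    | add x y hx hy => simpa using hadd _ _ hx hy
    | single n h => exact hosc n h
  | mul v w hv hw => exact hmul v w hv hw
  | add v w hv hw => exact hadd v w hv hw

lemma annih_add {L : Type*} [AddCommGroup L] (B : LinearMap.BilinForm ℤ L) (h k : Cartan L)
    (w : Fock L) : annih B (h + k) w = annih B h w + annih B k w := by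
  induction w using fock_induction with
  | hC a => simp [annih_algebraMap]
  | hosc n x => simp [annih_ι, mul_add]
  | hmul v w hv hw => simp only [annih_mul, hv, hw, smul_add]; abel
  | hadd v w hv hw => simp only [map_add, hv, hw]; abel

lemma annih_smul {L : Type*} [AddCommGroup L] (B : LinearMap.BilinForm ℤ L) (a : ℂ)
    (h : Cartan L) (w : Fock L) : annih B (a • h) w = a • annih B h w := by
  induction w using fock_induction with
  | hC b => simp [annih_algebraMap]
  | hosc n x =>
    rw [annih_ι, annih_ι, Polynomial.smul_monomial, map_smul, LinearMap.smul_apply,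
      ← algebraMap.coe_smul, smul_eq_mul, smul_eq_mul]
    congr 2
    ring
  | hmul v w hv hw =>
    simp only [annih_mul, hv, hw, smul_add]
    rw [smul_comm v a, smul_comm w a]
  | hadd v w hv hw => simp only [map_add, hv, hw, smul_add]

lemma annih_comm {L : Type*} [AddCommGroup L] (B : LinearMap.BilinForm ℤ L) (h k : Cartan L)
    (i j : ℕ) (w : Fock L) :
    (annih B k ((annih B h w).coeff i)).coeff j =
      (annih B h ((annih B k w).coeff j)).coeff i := by
  induction w using fock_induction with
  | hC a => simp [annih_algebraMap]
  | hosc n x =>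
    simp only [annih_ι, Polynomial.coeff_monomial]
    split_ifs <;> simp only [annih_algebraMap, map_zero, Polynomial.coeff_zero]
  | hmul v w hv hw =>
    simp only [annih_mul, Polynomial.coeff_add, Polynomial.coeff_smul, smul_eq_mul, map_add, hv, hw]
    ring
  | hadd v w hv hw => simp only [map_add, Polynomial.coeff_add, hv, hw]

/-- The creation part `∑_{i ≥ 0} (i+n choose n) h(-(i+n)-1) z^i` of the divided derivative
`∂^n h(z) / n!` of the field `h(z) = ∑_k h(k) z^(-k-1)`. -/
def creation {L : Type*} [AddCommGroup L] (n : ℕ) :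
    Cartan L →ₗ[ℂ] PowerSeries (Fock L) where
  toFun h := PowerSeries.mk fun i => ((i + n).choose n : ℂ) • osc (i + n) h
  map_add' h k := by ext i; simp [osc_add]
  map_smul' a h := by
    ext i
    simp only [osc_smul, PowerSeries.coeff_mk, RingHom.id_apply, PowerSeries.coeff_smul]
    rw [smul_comm]

/-- For `k ≥ 0` the coefficient `(-1)^n (k+n choose n) z^(-k-n-1)` of `h(k)` in
`∂^n h(z) / n!`. -/
def wt (L : Type*) [AddCommGroup L] (n k : ℕ) : LaurentSeries (Fock L) :=
  HahnSeries.single (-((k : ℤ) + n + 1)) ((-1) ^ n * ((k + n).choose n : Fock L))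

/-- For a field `A` the `ℂ`-linear map `∑_k w_k X^k ↦ ∑_k (-1)^n (k+n choose n) z^(-k-n-1) A w_k`. -/
def annPart {L : Type*} [AddCommGroup L] (n : ℕ) (A : FockField L) :
    Polynomial (Fock L) →ₗ[ℂ] LaurentSeries (Fock L) :=
  Polynomial.lsum fun k => mulK (wt L n k) ∘ₗ A

lemma annPart_eventually {L : Type*} [AddCommGroup L] (n : ℕ) (A : FockField L)
    (p : Polynomial (Fock L)) : ∀ᶠ N in Filter.atTop,
      annPart n A p = ∑ i ∈ Finset.range N, wt L n i * A (p.coeff i) := by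
  filter_upwards [Filter.eventually_gt_atTop p.natDegree] with N hN
  rw [annPart, Polynomial.lsum_apply, Polynomial.sum_over_range' _ _ N hN]
  · rfl
  · simp

/-- Left multiplication of fields by a series: `A(z) ↦ c(z) A(z)`. -/
def leftMul {L : Type*} [AddCommGroup L] (c : LaurentSeries (Fock L)) :
    Module.End ℂ (FockField L) where
  toFun A := mulK c ∘ₗ A
  map_add' A A' := by ext; simp
  map_smul' a A := by ext; simp

/-- `A(z) ↦ A(z) ∂^n h_{>0}(z) / n!`, where `h_{>0}(z) = ∑_{k ≥ 1} h(k) z^(-k-1)`. -/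
def rightAnnih {L : Type*} [AddCommGroup L] (B : LinearMap.BilinForm ℤ L) (n : ℕ)
    (h : Cartan L) : Module.End ℂ (FockField L) where
  toFun A := annPart n A ∘ₗ annih B h
  map_add' A A' := by
    ext1 w
    obtain ⟨N, h1, h2, h3⟩ := ((annPart_eventually n (A + A') (annih B h w)).and
      ((annPart_eventually n A (annih B h w)).and
        (annPart_eventually n A' (annih B h w)))).exists
    simp only [LinearMap.add_apply, LinearMap.comp_apply, h1, h2, h3, mul_add,
      Finset.sum_add_distrib]
  map_smul' a A := by
    ext1 w
    obtain ⟨N, h1, h2⟩ := ((annPart_eventually n (a • A) (annih B h w)).and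
      (annPart_eventually n A (annih B h w))).exists
    simp only [LinearMap.smul_apply, LinearMap.comp_apply, h1, h2, RingHom.id_apply,
      Finset.smul_sum]
    exact Finset.sum_congr rfl fun i _ => map_smul (mulK (wt L n i)) a _

lemma rightAnnih_comm {L : Type*} [AddCommGroup L] (B : LinearMap.BilinForm ℤ L) (n m : ℕ)
    (h k : Cartan L) : Commute (rightAnnih B n h) (rightAnnih B m k) := by
  have key (n m : ℕ) (h k : Cartan L) (A : FockField L) (w : Fock L) :
      ∀ᶠ N in Filter.atTop, rightAnnih B n h (rightAnnih B m k A) w =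
        ∑ i ∈ Finset.range N, ∑ j ∈ Finset.range N,
          wt L n i * (wt L m j * A ((annih B k ((annih B h w).coeff i)).coeff j)) := by
    have h1 := annPart_eventually n (rightAnnih B m k A) (annih B h w)
    have h2 : ∀ᶠ N in Filter.atTop, ∀ i ∈ Finset.range ((annih B h w).natDegree + 1),
        annPart m A (annih B k ((annih B h w).coeff i)) = ∑ j ∈ Finset.range N,
          wt L m j * A ((annih B k ((annih B h w).coeff i)).coeff j) :=
      (Filter.eventually_all_finset _).2 fun i _ => annPart_eventually m A _
    filter_upwards [h1, h2] with N h1 h2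
    change annPart n (rightAnnih B m k A) (annih B h w) = _
    rw [h1]
    refine Finset.sum_congr rfl fun i _ => ?_
    rw [← Finset.mul_sum]
    congr 1
    change annPart m A (annih B k ((annih B h w).coeff i)) = _
    by_cases hi : i ∈ Finset.range ((annih B h w).natDegree + 1)
    · exact h2 i hi
    · rw [Polynomial.coeff_eq_zero_of_natDegree_lt (by simpa using hi)]
      simp
  refine LinearMap.ext fun A => LinearMap.ext fun w => ?_
  obtain ⟨N, h1, h2⟩ := ((key n m h k A w).and (key m n k h A w)).exists
  change rightAnnih B n h (rightAnnih B m k A) w = rightAnnih B m k (rightAnnih B n h A) w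
  rw [h1, h2, Finset.sum_comm]
  refine Finset.sum_congr rfl fun i _ => Finset.sum_congr rfl fun j _ => ?_
  rw [annih_comm]
  ring

lemma leftMul_comm {L : Type*} [AddCommGroup L] (c d : LaurentSeries (Fock L)) :
    Commute (leftMul c) (leftMul d) := by
  refine LinearMap.ext fun A => LinearMap.ext fun w => ?_
  change c * (d * A w) = d * (c * A w)
  ring

lemma leftMul_rightAnnih_comm {L : Type*} [AddCommGroup L] (B : LinearMap.BilinForm ℤ L)
    (c : LaurentSeries (Fock L)) (n : ℕ) (h : Cartan L) :
    Commute (leftMul c) (rightAnnih B n h) := by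
  refine LinearMap.ext fun A => LinearMap.ext fun w => ?_
  obtain ⟨N, h1, h2⟩ := ((annPart_eventually n (leftMul c A) (annih B h w)).and
    (annPart_eventually n A (annih B h w))).exists
  change c * annPart n A (annih B h w) = annPart n (leftMul c A) (annih B h w)
  rw [h1, h2, Finset.mul_sum]
  refine Finset.sum_congr rfl fun i _ => ?_
  change _ = _ * (c * _)
  ring

/-- The normally ordered product `A(z) ↦ :(∂^n h(z) / n!) A(z):` on fields acting on
`M(1) ⊗ 𝔢_β`, on which `h(0)` acts as `⟨h, β⟩`: the creation part multiplies from the left, the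
rest from the right. -/
def normalOrd₁ {L : Type*} [AddCommGroup L] (B : LinearMap.BilinForm ℤ L) (β : L) (n : ℕ) :
    Cartan L →ₗ[ℂ] Module.End ℂ (FockField L) where
  toFun h := leftMul (HahnSeries.ofPowerSeries ℤ (Fock L) (creation n h)) +
    formC B h (toCartan β) • leftMul (wt L n 0) + rightAnnih B n h
  map_add' h k := by
    refine LinearMap.ext fun A => LinearMap.ext fun w => ?_
    have : annih B (h + k) = annih B h + annih B k := LinearMap.ext (annih_add B h k)
    simp [leftMul, rightAnnih, mulK, this, add_mul, add_smul]
    abel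
  map_smul' a h := by
    refine LinearMap.ext fun A => LinearMap.ext fun w => ?_
    have : annih B (a • h) = a • annih B h := LinearMap.ext (annih_smul B a h)
    have h2 : HahnSeries.ofPowerSeries ℤ (Fock L) (a • creation n h) =
        a • HahnSeries.ofPowerSeries ℤ (Fock L) (creation n h) := by
      rw [smul_eq_C_mul, ← HahnSeries.ofPowerSeries_C, ← map_mul]
      congr 1
      ext i
      rw [PowerSeries.coeff_smul, PowerSeries.coeff_C_mul, Algebra.smul_def]
    simp only [leftMul, rightAnnih, mulK, this, h2, map_smul, smul_add, smul_smul,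
      LinearMap.add_apply, LinearMap.smul_apply, LinearMap.coe_mk, AddHom.coe_mk,
      LinearMap.comp_apply, RingHom.id_apply, smul_eq_mul, smul_eq_C_mul, map_mul]
    ring

/-- `normalOrd B β x` for `x = ∑ₙ h_n t^(-n-1)` is the normally ordered product with the field
`∑ₙ ∂^n h_n(z) / n!`, on fields acting on `M(1) ⊗ 𝔢_β`. -/
def normalOrd {L : Type*} [AddCommGroup L] (B : LinearMap.BilinForm ℤ L) (β : L) :
    (ℕ →₀ Cartan L) →ₗ[ℂ] Module.End ℂ (FockField L) :=
  Finsupp.lsum ℂ fun n => normalOrd₁ B β n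

lemma commute_add_smul_add {A : Type*} [Semiring A] [Algebra ℂ A] {a b c a' b' c' : A} (s t : ℂ)
    (h1 : Commute a a') (h2 : Commute a b') (h3 : Commute a c')
    (h4 : Commute b a') (h5 : Commute b b') (h6 : Commute b c')
    (h7 : Commute c a') (h8 : Commute c b') (h9 : Commute c c') :
    Commute (a + s • b + c) (a' + t • b' + c') :=
  .add_left
    (.add_left (.add_right (.add_right h1 (h2.smul_right _)) h3)
      (.add_right (.add_right (h4.smul_left _) ((h5.smul_left _).smul_right _))
        (h6.smul_left _)))
    (.add_right (.add_right h7 (h8.smul_right _)) h9)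

lemma normalOrd_comm {L : Type*} [AddCommGroup L] (B : LinearMap.BilinForm ℤ L) (β : L)
    (x y : ℕ →₀ Cartan L) : Commute (normalOrd B β x) (normalOrd B β y) := by
  induction x using Finsupp.induction_linear with
  | zero => simp
  | add x x' hx hx' => rw [map_add]; exact hx.add_left hx'
  | single n h =>
    induction y using Finsupp.induction_linear with
    | zero => simp
    | add y y' hy hy' => rw [map_add]; exact hy.add_right hy'
    | single m k =>
      simp only [normalOrd, Finsupp.lsum_single, normalOrd₁, LinearMap.coe_mk, AddHom.coe_mk]
      exact commute_add_smul_add _ _ (leftMul_comm _ _) (leftMul_comm _ _)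
        (leftMul_rightAnnih_comm B _ _ _) (leftMul_comm _ _) (leftMul_comm _ _)
        (leftMul_rightAnnih_comm B _ _ _) (leftMul_rightAnnih_comm B _ _ _).symm
        (leftMul_rightAnnih_comm B _ _ _).symm (rightAnnih_comm B _ _ _ _)

/-- The series `∑_{n ≥ 1} α(-n) z^n / n`. -/
def expArg {L : Type*} [AddCommGroup L] (α : L) : PowerSeries (Fock L) :=
  PowerSeries.X * PowerSeries.mk fun n => ((n : ℂ) + 1)⁻¹ • osc n (toCartan α)

/-- `exp(∑_{n ≥ 1} α(-n) z^n / n)`. -/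
def expPlus {L : Type*} [AddCommGroup L] (α : L) : PowerSeries (Fock L) :=
  (PowerSeries.exp ℂ).subst (expArg α)

/-- The operator `exp(-∑_{n ≥ 1} α(n) z^(-n) / n)` on `M(1)`, with `X = z⁻¹`: it is the algebra
automorphism `h(-n) ↦ h(-n) - ⟨α, h⟩ z^(-n)`, since `α(n)` is the derivation with
`α(n) h(-m) = n ⟨α, h⟩ δ_{n,m}`. -/
def expMinus {L : Type*} [AddCommGroup L] (B : LinearMap.BilinForm ℤ L) (α : L) :
    Fock L →ₐ[ℂ] Polynomial (Fock L) :=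
  SymmetricAlgebra.lift
    ((Polynomial.CAlgHom (R := ℂ) (A := Fock L)).toLinearMap ∘ₗ SymmetricAlgebra.ι ℂ _ -
      Finsupp.lsum ℂ fun n : ℕ =>
        (Polynomial.monomial (R := Fock L) (n + 1)).restrictScalars ℂ ∘ₗ
            Algebra.linearMap ℂ (Fock L) ∘ₗ formC B (toCartan α))

/-- The map `∑_k w_k X^k ↦ ∑_k w_k z^(-k)`. -/
def evalInv (L : Type*) [AddCommGroup L] : Polynomial (Fock L) →ₗ[ℂ] LaurentSeries (Fock L) :=
  Polynomial.lsum fun k =>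
    { toFun := HahnSeries.single (-(k : ℤ))
      map_add' := fun v w => by simp
      map_smul' := fun a v => by ext; simp [HahnSeries.coeff_single] }

/-- The operator `exp(∑_{n ≥ 1} α(-n) z^n / n) exp(-∑_{n ≥ 1} α(n) z^(-n) / n)` on `M(1)`. -/
def expField {L : Type*} [AddCommGroup L] (B : LinearMap.BilinForm ℤ L) (α : L) :
    FockField L :=
  mulK (HahnSeries.ofPowerSeries ℤ (Fock L) (expPlus α)) ∘ₗ evalInv L ∘ₗ
    (expMinus B α).toLinearMap

/-- The `M(1)`-part of the vertex operator of `u ⊗ 𝔢_α` on `M(1) ⊗ 𝔢_β`: for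
`u = h₁(-n₁-1) ⋯ h_r(-n_r-1)` it is
`:(∂^n₁ h₁(z) / n₁!) ⋯ (∂^n_r h_r(z) / n_r!) exp(…) exp(…):`. -/
def fockVertex {L : Type*} [AddCommGroup L] (B : LinearMap.BilinForm ℤ L) (α β : L) :
    Fock L →ₗ[ℂ] FockField L where
  toFun u := symLift (A := Module.End ℂ (FockField L)) (normalOrd B β) (normalOrd_comm B β) u (expField B α)
  map_add' u v := by simp
  map_smul' a u := by simp

/-- The coefficient of `z^n`. -/
def coeffK (L : Type*) [AddCommGroup L] (n : ℤ) : LaurentSeries (Fock L) →ₗ[ℂ] Fock L where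
  toFun x := x.coeff n
  map_add' _ _ := rfl
  map_smul' _ _ := rfl

/-- The `n`-th product `v_(n) w` of `V_L`, i.e. `Y(v, z) w = ∑ₙ (v_(n) w) z^(-n-1)`, where
`Y(u ⊗ 𝔢_α, z) (w ⊗ 𝔢_β)` is `ε(α,β) z^⟨α,β⟩ (fockVertex B α β u w)(z) ⊗ 𝔢_{α+β}`. -/
def nthProduct {L : Type*} [AddCommGroup L] (B : LinearMap.BilinForm ℤ L) (ε : L → L → ℤˣ)
    (n : ℤ) : Space L →ₗ[ℂ] Space L →ₗ[ℂ] Space L :=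
  Finsupp.lsum ℂ fun α => LinearMap.flip <| Finsupp.lsum ℂ fun β => LinearMap.flip <|
    ((ε α β : ℤ) : ℂ) • LinearMap.compr₂ (fockVertex B α β)
      (Finsupp.lsingle (α + β) ∘ₗ coeffK L (-n - 1 - B α β))

lemma nthProduct_single {L : Type*} [AddCommGroup L] (B : LinearMap.BilinForm ℤ L)
    (ε : L → L → ℤˣ) (n : ℤ) (α β : L) (u w : Fock L) :
    nthProduct B ε n (Finsupp.single α u) (Finsupp.single β w) =
      ((ε α β : ℤ) : ℂ) •
        Finsupp.single (α + β) ((fockVertex B α β u w).coeff (-n - 1 - B α β)) := by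
  simp [nthProduct, coeffK]

/-! ### Automorphisms of `V_L` -/

/-- The automorphism group of the vertex operator algebra `V_L`: the linear automorphisms that
preserve the vacuum vector, the conformal vector and all `n`-th products. -/
def Aut {L : Type*} [AddCommGroup L] [Module.Free ℤ L] [Module.Finite ℤ L]
    (B : LinearMap.BilinForm ℤ L) (ε : L → L → ℤˣ) : Subgroup (Space L ≃ₗ[ℂ] Space L) where
  carrier := {g | g (vacuum ε) = vacuum ε ∧ g (conformal B ε) = conformal B ε ∧
    ∀ (n : ℤ) (v w : Space L), g (nthProduct B ε n v w) = nthProduct B ε n (g v) (g w)}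
  mul_mem' {f g} hf hg := by
    obtain ⟨f1, f2, f3⟩ := hf
    obtain ⟨g1, g2, g3⟩ := hg
    exact ⟨by rw [LinearEquiv.mul_apply, g1, f1], by rw [LinearEquiv.mul_apply, g2, f2],
      fun n v w => by simp only [LinearEquiv.mul_apply, g3, f3]⟩
  one_mem' := ⟨rfl, rfl, fun _ _ _ => rfl⟩
  inv_mem' {g} hg := by
    obtain ⟨g1, g2, g3⟩ := hg
    have h (v : Space L) : g (g⁻¹ v) = v := g.apply_symm_apply v
    have h' (v : Space L) : g⁻¹ (g v) = v := g.symm_apply_apply v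
    refine ⟨?_, ?_, fun n v w => ?_⟩
    · nth_rw 1 [← g1, h']
    · nth_rw 1 [← g2, h']
    · rw [← h' (nthProduct B ε n (g⁻¹ v) (g⁻¹ w)), g3, h, h]

/-- The action of an isometry `ν` on `M(1)`: the algebra automorphism `h(-n) ↦ (ν h)(-n)`. -/
def fockMap {L : Type*} [AddCommGroup L] (ν : L ≃ₗ[ℤ] L) : Fock L →ₐ[ℂ] Fock L :=
  SymmetricAlgebra.lift (SymmetricAlgebra.ι ℂ _ ∘ₗ Finsupp.mapRange.linearMap (extC ν))

lemma fockMap_osc {L : Type*} [AddCommGroup L] (ν : L ≃ₗ[ℤ] L) (n : ℕ) (h : Cartan L) :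
    fockMap ν (osc n h) = osc n (extC ν h) := by
  simp [fockMap, osc]

lemma fockMap_one {L : Type*} [AddCommGroup L] (w : Fock L) :
    fockMap (1 : L ≃ₗ[ℤ] L) w = w := by
  have h1 (h : Cartan L) : extC (1 : L ≃ₗ[ℤ] L) h = h :=
    congrArg (fun f => f h) (LinearMap.baseChange_id (R := ℤ) (A := ℂ) (M := L))
  induction w using fock_induction with
  | hC a => exact (fockMap _).commutes a
  | hosc n h => rw [fockMap_osc, h1]
  | hmul v w hv hw => rw [map_mul, hv, hw]
  | hadd v w hv hw => rw [map_add, hv, hw]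

lemma fockMap_mul {L : Type*} [AddCommGroup L] (μ ν : L ≃ₗ[ℤ] L) (w : Fock L) :
    fockMap (μ * ν) w = fockMap μ (fockMap ν w) := by
  have h1 (h : Cartan L) : extC (μ * ν) h = extC μ (extC ν h) :=
    congrArg (fun f => f h)
      (LinearMap.baseChange_comp (A := ℂ) (f := (ν : L →ₗ[ℤ] L)) (μ : L →ₗ[ℤ] L))
  induction w using fock_induction with
  | hC a => simp only [AlgHom.commutes]
  | hosc n h => rw [fockMap_osc, fockMap_osc, fockMap_osc, h1]
  | hmul v w hv hw => rw [map_mul, map_mul, map_mul, hv, hw]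
  | hadd v w hv hw => rw [map_add, map_add, map_add, hv, hw]

/-- The linear map `u ⊗ 𝔢_α ↦ χ(α) ν(u) ⊗ 𝔢_{να}` on `V_L`. -/
def twistMap {L : Type*} [AddCommGroup L] (ν : L ≃ₗ[ℤ] L) (χ : L → ℂˣ) :
    Space L →ₗ[ℂ] Space L :=
  Finsupp.lsum ℂ fun α => (χ α : ℂ) • (Finsupp.lsingle (ν α) ∘ₗ (fockMap ν).toLinearMap)

lemma twistMap_single {L : Type*} [AddCommGroup L] (ν : L ≃ₗ[ℤ] L) (χ : L → ℂˣ) (α : L)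
    (u : Fock L) :
    twistMap ν χ (Finsupp.single α u) = (χ α : ℂ) • Finsupp.single (ν α) (fockMap ν u) := by
  simp [twistMap]

/-- `twistMap` as an invertible map. -/
def twist {L : Type*} [AddCommGroup L] (ν : L ≃ₗ[ℤ] L) (χ : L → ℂˣ) :
    Space L ≃ₗ[ℂ] Space L :=
  LinearEquiv.ofLinearMap (twistMap ν χ) (twistMap ν⁻¹ fun α => (χ (ν⁻¹ α))⁻¹)
    (by
      refine Finsupp.lhom_ext fun α u => ?_
      simp only [LinearMap.comp_apply, twistMap_single, map_smul, smul_smul, ← fockMap_mul,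
        ← LinearEquiv.mul_apply, mul_inv_cancel, fockMap_one]
      simp)
    (by
      refine Finsupp.lhom_ext fun α u => ?_
      simp only [LinearMap.comp_apply, twistMap_single, map_smul, smul_smul, ← fockMap_mul,
        ← LinearEquiv.mul_apply, inv_mul_cancel, fockMap_one]
      simp)

lemma twist_single {L : Type*} [AddCommGroup L] (ν : L ≃ₗ[ℤ] L) (χ : L → ℂˣ) (α : L)
    (u : Fock L) :
    twist ν χ (Finsupp.single α u) = (χ α : ℂ) • Finsupp.single (ν α) (fockMap ν u) :=
  twistMap_single ν χ α u

lemma extC_toCartan {L : Type*} [AddCommGroup L] (ν : L ≃ₗ[ℤ] L) (α : L) :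
    extC ν (toCartan α) = toCartan (ν α) := rfl

lemma formC_extC {L : Type*} [AddCommGroup L] {B : LinearMap.BilinForm ℤ L} {ν : L ≃ₗ[ℤ] L}
    (hν : ν ∈ isometryGroup B) (h k : Cartan L) : formC B (extC ν h) (extC ν k) = formC B h k := by
  induction h using TensorProduct.induction_on with
  | zero => simp
  | add x y hx hy => simp only [map_add, LinearMap.add_apply, hx, hy]
  | tmul a α =>
    induction k using TensorProduct.induction_on with
    | zero => simp
    | add x y hx hy => simp only [map_add, hx, hy]
    | tmul b β =>
      have : B (ν α) (ν β) = B α β := hν α β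
      simp [extC, this]

/-- The coefficientwise action of `ν` on `M(1)((z))`. -/
def mapK {L : Type*} [AddCommGroup L] (ν : L ≃ₗ[ℤ] L) (x : LaurentSeries (Fock L)) :
    LaurentSeries (Fock L) := x.map (fockMap ν)

lemma mapK_mul {L : Type*} [AddCommGroup L] (ν : L ≃ₗ[ℤ] L) (x y : LaurentSeries (Fock L)) :
    mapK ν (x * y) = mapK ν x * mapK ν y :=
  HahnSeries.map_mul (fockMap ν : Fock L →ₙ+* Fock L)

lemma mapK_add {L : Type*} [AddCommGroup L] (ν : L ≃ₗ[ℤ] L) (x y : LaurentSeries (Fock L)) :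
    mapK ν (x + y) = mapK ν x + mapK ν y := by
  ext n
  simp [mapK]

lemma mapK_smul {L : Type*} [AddCommGroup L] (ν : L ≃ₗ[ℤ] L) (a : ℂ)
    (x : LaurentSeries (Fock L)) : mapK ν (a • x) = a • mapK ν x := by
  ext n
  simp [mapK]

lemma mapK_zero {L : Type*} [AddCommGroup L] (ν : L ≃ₗ[ℤ] L) :
    mapK ν (0 : LaurentSeries (Fock L)) = 0 := by
  ext n
  simp [mapK]

lemma mapK_sum {L : Type*} [AddCommGroup L] (ν : L ≃ₗ[ℤ] L) (s : Finset ℕ)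
    (f : ℕ → LaurentSeries (Fock L)) : mapK ν (∑ i ∈ s, f i) = ∑ i ∈ s, mapK ν (f i) := by
  classical
  induction s using Finset.induction_on with
  | empty => simpa using mapK_zero ν
  | insert i s hi ih => rw [Finset.sum_insert hi, Finset.sum_insert hi, mapK_add, ih]

lemma mapK_wt {L : Type*} [AddCommGroup L] (ν : L ≃ₗ[ℤ] L) (n k : ℕ) :
    mapK ν (wt L n k) = wt L n k := by
  ext m
  simp only [mapK, wt, HahnSeries.map_coeff, HahnSeries.coeff_single]
  split_ifs <;> simp

lemma mapK_ofPowerSeries {L : Type*} [AddCommGroup L] (ν : L ≃ₗ[ℤ] L)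
    (p : PowerSeries (Fock L)) :
    mapK ν (HahnSeries.ofPowerSeries ℤ (Fock L) p) =
      HahnSeries.ofPowerSeries ℤ (Fock L) (PowerSeries.map (fockMap ν : Fock L →+* Fock L) p) := by
  ext n
  rcases lt_or_ge n 0 with hn | hn
  · have h (q : PowerSeries (Fock L)) : (HahnSeries.ofPowerSeries ℤ (Fock L) q).coeff n = 0 := by
      rw [HahnSeries.ofPowerSeries_apply]
      apply HahnSeries.embDomain_of_notMem_range
      rintro ⟨m, hm⟩
      have : (m : ℤ) = n := hm
      omega
    simp [mapK, h]
  · lift n to ℕ using hn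
    simp [mapK]

lemma annih_map {L : Type*} [AddCommGroup L] {B : LinearMap.BilinForm ℤ L} {ν : L ≃ₗ[ℤ] L}
    (hν : ν ∈ isometryGroup B) (h : Cartan L) (w : Fock L) (i : ℕ) :
    (annih B (extC ν h) (fockMap ν w)).coeff i = fockMap ν ((annih B h w).coeff i) := by
  induction w using fock_induction with
  | hC a => rw [AlgHom.commutes, annih_algebraMap, annih_algebraMap]; simp
  | hosc n k =>
    rw [fockMap_osc, annih_ι, annih_ι, formC_extC hν, Polynomial.coeff_monomial]
    split_ifs
    · rw [AlgHom.commutes]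
    · simp
  | hmul v w hv hw =>
    simp only [map_mul, annih_mul, Polynomial.coeff_add, Polynomial.coeff_smul, smul_eq_mul,
      hv, hw, map_add]
  | hadd v w hv hw => simp only [map_add, Polynomial.coeff_add, hv, hw]

lemma creation_map {L : Type*} [AddCommGroup L] (ν : L ≃ₗ[ℤ] L) (n : ℕ) (h : Cartan L) :
    PowerSeries.map (fockMap ν : Fock L →+* Fock L) (creation n h) = creation n (extC ν h) := by
  ext i
  simp [creation, fockMap_osc]

/-- The fields `A` and `A'` are intertwined by `ν`. -/
def Intertwined {L : Type*} [AddCommGroup L] (ν : L ≃ₗ[ℤ] L) (A A' : FockField L) : Prop :=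
  ∀ w, A' (fockMap ν w) = mapK ν (A w)

lemma normalOrd₁_map {L : Type*} [AddCommGroup L] {B : LinearMap.BilinForm ℤ L} {ν : L ≃ₗ[ℤ] L}
    (hν : ν ∈ isometryGroup B) (β : L) (n : ℕ) (h : Cartan L) {A A' : FockField L}
    (hA : Intertwined ν A A') :
    Intertwined ν (normalOrd₁ B β n h A) (normalOrd₁ B (ν β) n (extC ν h) A') := by
  intro w
  obtain ⟨N, h1, h2⟩ := ((annPart_eventually n A' (annih B (extC ν h) (fockMap ν w))).and
    (annPart_eventually n A (annih B h w))).exists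
  change HahnSeries.ofPowerSeries ℤ (Fock L) (creation n (extC ν h)) * A' (fockMap ν w) +
    formC B (extC ν h) (toCartan (ν β)) • (wt L n 0 * A' (fockMap ν w)) +
    annPart n A' (annih B (extC ν h) (fockMap ν w)) =
    mapK ν (HahnSeries.ofPowerSeries ℤ (Fock L) (creation n h) * A w +
      formC B h (toCartan β) • (wt L n 0 * A w) + annPart n A (annih B h w))
  rw [h1, h2, mapK_add, mapK_add, mapK_mul, mapK_smul, mapK_mul, mapK_wt, mapK_ofPowerSeries,
    creation_map, ← hA, ← extC_toCartan, formC_extC hν, mapK_sum]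
  congr 1
  refine Finset.sum_congr rfl fun i _ => ?_
  rw [mapK_mul, mapK_wt, annih_map hν, hA]

lemma symLift_map {L : Type*} [AddCommGroup L] {B : LinearMap.BilinForm ℤ L} {ν : L ≃ₗ[ℤ] L}
    (hν : ν ∈ isometryGroup B) (β : L) (u : Fock L) : ∀ {A A' : FockField L},
    Intertwined ν A A' → Intertwined ν
      (symLift (A := Module.End ℂ (FockField L)) (normalOrd B β) (normalOrd_comm B β) u A)
      (symLift (A := Module.End ℂ (FockField L)) (normalOrd B (ν β)) (normalOrd_comm B (ν β))
        (fockMap ν u) A') := by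
  induction u using fock_induction with
  | hC a =>
    intro A A' hA w
    rw [AlgHom.commutes, AlgHom.commutes, AlgHom.commutes]
    change a • A' (fockMap ν w) = mapK ν (a • A w)
    rw [mapK_smul, hA]
  | hosc n h =>
    intro A A' hA
    rw [fockMap_osc, osc, osc, symLift_ι, symLift_ι, normalOrd, normalOrd, Finsupp.lsum_single,
      Finsupp.lsum_single]
    exact normalOrd₁_map hν β n h hA
  | hmul v w hv hw =>
    intro A A' hA
    rw [map_mul, map_mul, map_mul]
    exact hv (hw hA)
  | hadd v w hv hw =>
    intro A A' hA x
    rw [map_add, map_add, map_add, LinearMap.add_apply, LinearMap.add_apply, LinearMap.add_apply,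
      LinearMap.add_apply, mapK_add, hv hA, hw hA]

lemma expMinus_osc {L : Type*} [AddCommGroup L] (B : LinearMap.BilinForm ℤ L) (α : L) (n : ℕ)
    (h : Cartan L) : expMinus B α (osc n h) = Polynomial.C (osc n h) -
      Polynomial.monomial (n + 1) (algebraMap ℂ (Fock L) (formC B (toCartan α) h)) := by
  simp [expMinus, osc]

lemma expMinus_map {L : Type*} [AddCommGroup L] {B : LinearMap.BilinForm ℤ L} {ν : L ≃ₗ[ℤ] L}
    (hν : ν ∈ isometryGroup B) (α : L) (w : Fock L) :
    expMinus B (ν α) (fockMap ν w) =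
      Polynomial.map (fockMap ν : Fock L →+* Fock L) (expMinus B α w) := by
  induction w using fock_induction with
  | hC a =>
    rw [AlgHom.commutes, AlgHom.commutes, AlgHom.commutes, Polynomial.algebraMap_apply]
    simp
  | hosc n h =>
    rw [fockMap_osc, expMinus_osc, expMinus_osc, ← extC_toCartan, formC_extC hν]
    simp [fockMap_osc]
  | hmul v w hv hw => rw [map_mul, map_mul, map_mul, Polynomial.map_mul, hv, hw]
  | hadd v w hv hw => rw [map_add, map_add, map_add, Polynomial.map_add, hv, hw]

lemma evalInv_map {L : Type*} [AddCommGroup L] (ν : L ≃ₗ[ℤ] L) (p : Polynomial (Fock L)) :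
    evalInv L (Polynomial.map (fockMap ν : Fock L →+* Fock L) p) = mapK ν (evalInv L p) := by
  induction p using Polynomial.induction_on' with
  | add p q hp hq => rw [Polynomial.map_add, map_add, map_add, mapK_add, hp, hq]
  | monomial n a => 
    ext m
    simp only [mapK, evalInv, Polynomial.lsum_apply, Polynomial.map_monomial, LinearMap.coe_mk,
      AddHom.coe_mk, Polynomial.sum_monomial_index, map_zero, HahnSeries.map_coeff,
      HahnSeries.coeff_single]
    split_ifs <;> simp

lemma expPlus_map {L : Type*} [AddCommGroup L] (ν : L ≃ₗ[ℤ] L) (α : L) :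
    PowerSeries.map (fockMap ν : Fock L →+* Fock L) (expPlus α) = expPlus (ν α) := by
  have harg : PowerSeries.map (fockMap ν : Fock L →+* Fock L) (expArg α) = expArg (ν α) := by
    simp only [expArg, map_mul, PowerSeries.map_X]
    congr 1
    ext i
    simp [fockMap_osc, extC_toCartan]
  have hs (β : L) : PowerSeries.HasSubst (expArg β) :=
    PowerSeries.HasSubst.of_constantCoeff_zero' (by simp [expArg])
  ext n
  rw [PowerSeries.coeff_map, expPlus, expPlus, PowerSeries.coeff_subst' (hs _),
    PowerSeries.coeff_subst' (hs _)]
  rw [map_finsum (fockMap ν : Fock L →+* Fock L) (PowerSeries.coeff_subst_finite' (hs α) _ n)]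
  refine finsum_congr fun d => ?_
  rw [← harg, ← map_pow, PowerSeries.coeff_map]
  simp

lemma expField_map {L : Type*} [AddCommGroup L] {B : LinearMap.BilinForm ℤ L} {ν : L ≃ₗ[ℤ] L}
    (hν : ν ∈ isometryGroup B) (α : L) :
    Intertwined ν (expField B α) (expField B (ν α)) := by
  intro w
  change HahnSeries.ofPowerSeries ℤ (Fock L) (expPlus (ν α)) *
    evalInv L (expMinus B (ν α) (fockMap ν w)) =
    mapK ν (HahnSeries.ofPowerSeries ℤ (Fock L) (expPlus α) * evalInv L (expMinus B α w))
  rw [mapK_mul, mapK_ofPowerSeries, expPlus_map, expMinus_map hν, evalInv_map]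

lemma fockVertex_map {L : Type*} [AddCommGroup L] {B : LinearMap.BilinForm ℤ L} {ν : L ≃ₗ[ℤ] L}
    (hν : ν ∈ isometryGroup B) (α β : L) (u w : Fock L) :
    fockVertex B (ν α) (ν β) (fockMap ν u) (fockMap ν w) = mapK ν (fockVertex B α β u w) :=
  symLift_map hν β u (expField_map hν α) w

lemma conformal_sum_map {L : Type*} [AddCommGroup L] {B : LinearMap.BilinForm ℤ L}
    {ν : L ≃ₗ[ℤ] L} (hν : ν ∈ isometryGroup B) {ι : Type*} [Fintype ι] [DecidableEq ι]
    (b : Module.Basis ι ℤ L) (G : Matrix ι ι ℂ)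
    (hG : G = Matrix.of fun i j => ((B (b i) (b j) : ℤ) : ℂ)) (v : Space L) :
    ∑ i, ∑ j, G⁻¹ i j • ((osc 0 (toCartan (ν (b i))) * osc 0 (toCartan (ν (b j)))) • v) =
      ∑ i, ∑ j, G⁻¹ i j • ((osc 0 (toCartan (b i)) * osc 0 (toCartan (b j))) • v) := by
  set N : Matrix ι ι ℂ := Matrix.of fun k i => ((b.repr (ν (b i)) k : ℤ) : ℂ) with hN
  have hνb (i : ι) : ν (b i) = ∑ k, b.repr (ν (b i)) k • b k := (b.sum_repr _).symm
  have hosc (i : ι) : osc 0 (toCartan (ν (b i))) = ∑ k, N k i • osc 0 (toCartan (b k)) := by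
    let f : L →ₗ[ℤ] Fock L :=
      { toFun := fun α => osc 0 (toCartan α)
        map_add' := fun x y => by simp [toCartan, TensorProduct.tmul_add, osc_add]
        map_smul' := fun a x => by
          have : toCartan (a • x) = (a : ℂ) • toCartan x := by
            simp [toCartan, TensorProduct.smul_tmul']
          rw [this, osc_smul]
          simp [Algebra.smul_def] }
    have := congrArg f (hνb i)
    rw [map_sum] at this
    refine this.trans (Finset.sum_congr rfl fun k _ => ?_)
    rw [map_smul]
    change _ • osc 0 (toCartan (b k)) = _
    simp [N, Algebra.smul_def]
  have hNG : N.transpose * G * N = G := by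
    ext i j
    have h1 : B (ν (b i)) (ν (b j)) = B (b i) (b j) := hν _ _
    rw [hνb i, hνb j] at h1
    simp only [map_sum, LinearMap.sum_apply, map_smul, LinearMap.smul_apply, smul_eq_mul] at h1
    have h2 := congrArg (Int.cast : ℤ → ℂ) h1
    push_cast at h2
    rw [hG]
    simp only [Matrix.mul_apply, Matrix.transpose_apply, Matrix.of_apply, N]
    rw [← h2]
    refine Finset.sum_congr rfl fun k _ => ?_
    exact mul_comm _ _
  have hNunit : IsUnit N.det := by
    set M : Matrix ι ι ℂ := Matrix.of fun k i => ((b.repr (ν⁻¹ (b i)) k : ℤ) : ℂ)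
    refine Matrix.isUnit_det_of_left_inverse (B := M) ?_
    ext i j
    have h1 : b.repr (ν⁻¹ (ν (b j))) i = b.repr (b j) i := by
      congr 2
      exact ν.symm_apply_apply _
    rw [hνb j] at h1
    simp only [map_sum, map_smul, Finsupp.coe_finsetSum, Finset.sum_apply, Finsupp.smul_apply,
      smul_eq_mul, Module.Basis.repr_self, Finsupp.single_apply] at h1
    have h2 := congrArg (Int.cast : ℤ → ℂ) h1
    push_cast at h2
    simp only [Matrix.mul_apply, M, N, Matrix.of_apply, Matrix.one_apply]
    simp only [eq_comm (a := i), ← h2]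
    exact Finset.sum_congr rfl fun k _ => mul_comm _ _
  have hinv : N * G⁻¹ * N.transpose = G⁻¹ := by
    have h1 := congrArg (fun X => N * X⁻¹ * N.transpose) hNG
    simp only [Matrix.mul_inv_rev] at h1
    rw [← h1]
    have hNt : IsUnit N.transpose.det := by rwa [Matrix.det_transpose]
    simp only [← Matrix.mul_assoc]
    rw [Matrix.mul_nonsing_inv _ hNunit, Matrix.one_mul, Matrix.mul_assoc,
      Matrix.nonsing_inv_mul _ hNt, Matrix.mul_one]
  have hkl (k l : ι) : ∑ i, ∑ j, G⁻¹ i j * (N k i * N l j) = G⁻¹ k l := by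
    conv_rhs => rw [← hinv]
    simp only [Matrix.mul_apply, Matrix.transpose_apply, Finset.sum_mul]
    rw [Finset.sum_comm]
    exact Finset.sum_congr rfl fun j _ => Finset.sum_congr rfl fun i _ => by ring
  simp only [hosc, Finset.sum_mul, Finset.mul_sum, Finset.sum_smul, Finset.smul_sum,
    smul_mul_smul_comm, smul_assoc, smul_smul]
  calc _ = ∑ k, ∑ l, ∑ i, ∑ j, (G⁻¹ i j * (N k i * N l j)) •
        ((osc 0 (toCartan (b k)) * osc 0 (toCartan (b l))) • v) := by
        rw [Finset.sum_congr rfl fun i _ => Finset.sum_congr rfl fun j _ => Finset.sum_comm,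
          Finset.sum_congr rfl fun i _ => Finset.sum_comm, Finset.sum_comm,
          Finset.sum_congr rfl fun k _ => Finset.sum_congr rfl fun i _ => Finset.sum_comm,
          Finset.sum_congr rfl fun k _ => Finset.sum_comm]
    _ = _ := by
        simp only [← Finset.sum_smul, hkl]

lemma twist_mem_aut {L : Type*} [AddCommGroup L] [Module.Free ℤ L] [Module.Finite ℤ L]
    {B : LinearMap.BilinForm ℤ L} {ε : L → L → ℤˣ} {ν : L ≃ₗ[ℤ] L} (hν : ν ∈ isometryGroup B)
    {χ : L → ℂˣ}
    (hχ : ∀ α β, (χ α : ℂ) * χ β * ((ε (ν α) (ν β) : ℤ) : ℂ) = ((ε α β : ℤ) : ℂ) * χ (α + β)) :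
    twist ν χ ∈ Aut B ε := by
  have h0 : (χ 0 : ℂ) = 1 := by
    have h := hχ 0 0
    rw [map_zero, add_zero] at h
    have hε : ((ε 0 0 : ℤ) : ℂ) ≠ 0 := by simp
    have h1 : (χ 0 : ℂ) ≠ 0 := (χ 0).ne_zero
    have h2 : ((ε 0 0 : ℤ) : ℂ) * χ 0 * (χ 0 - 1) = 0 := by linear_combination h
    simpa [hε, h1, sub_eq_zero] using h2
  have hvac (u : Fock L) : twist ν χ (u • vacuum ε) = fockMap ν u • vacuum ε := by
    rw [vacuum, Finsupp.smul_single, Finsupp.smul_single, twist_single, h0, one_smul, map_zero,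
      smul_eq_mul, smul_eq_mul, map_mul, map_intCast]
  refine ⟨?_, ?_, fun n v w => ?_⟩
  · simpa using hvac 1
  · simp only [conformal, map_smul, map_sum, hvac, map_mul, fockMap_osc, extC_toCartan]
    congr 1
    exact conformal_sum_map hν _ _ rfl _
  · induction v using Finsupp.induction_linear with
    | zero => simp
    | add v v' hv hv' => simp only [map_add, LinearMap.add_apply, hv, hv']
    | single α u =>
      induction w using Finsupp.induction_linear with
      | zero => simp
      | add w w' hw hw' => simp only [map_add, hw, hw']
      | single β w =>
        have hB : B (ν α) (ν β) = B α β := hν α β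
        rw [nthProduct_single, map_smul, twist_single, twist_single, twist_single, map_smul,
          map_smul, LinearMap.smul_apply, nthProduct_single, fockVertex_map hν, hB, map_add]
        simp only [smul_smul, mapK, HahnSeries.map_coeff]
        congr 1
        linear_combination -hχ α β

/-! ### Lifts of isometries and the automorphisms `e^{h(0)}` -/

/-- The condition `η(α) η(β) / η(α+β) = ε(α,β) / ε(να,νβ)` for `ν` and `η : L → {±1}` to define
a lift `φ_η(ν)`. -/
def IsLift {L : Type*} [AddCommGroup L] (ε : L → L → ℤˣ) (ν : L ≃ₗ[ℤ] L) (η : L → ℤˣ) : Prop :=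
  ∀ α β, η α * η β / η (α + β) = ε α β / ε (ν α) (ν β)

/-- The lift is standard: `η` is trivial on the fixed-point sublattice `L^ν`. -/
def IsStandard {L : Type*} [AddCommGroup L] (ν : L ≃ₗ[ℤ] L) (η : L → ℤˣ) : Prop :=
  ∀ α, ν α = α → η α = 1

/-- The lift `φ_η(ν)` of `ν`, acting on `V_L` by `u ⊗ 𝔢_α ↦ ν(u) ⊗ η(α) 𝔢_{να}`. -/
def lift {L : Type*} [AddCommGroup L] [Module.Free ℤ L] [Module.Finite ℤ L]
    (B : LinearMap.BilinForm ℤ L) (ε : L → L → ℤˣ) (ν : isometryGroup B) (η : L → ℤˣ)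
    (hη : IsLift ε (ν : L ≃ₗ[ℤ] L) η) : Aut B ε :=
  ⟨twist ν fun α => Units.map (Int.castRingHom ℂ) (η α), twist_mem_aut ν.2 fun α β => by
    have h := hη α β
    rw [div_eq_div_iff_mul_eq_mul] at h
    have h2 := congrArg (fun x : ℤˣ => ((x : ℤ) : ℂ)) h
    simpa using h2⟩

lemma lift_single {L : Type*} [AddCommGroup L] [Module.Free ℤ L] [Module.Finite ℤ L]
    (B : LinearMap.BilinForm ℤ L) (ε : L → L → ℤˣ) (ν : isometryGroup B) (η : L → ℤˣ)
    (hη : IsLift ε (ν : L ≃ₗ[ℤ] L) η) (α : L) (u : Fock L) :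
    (lift B ε ν η hη : Space L ≃ₗ[ℂ] Space L) (Finsupp.single α u) =
      ((η α : ℤ) : ℂ) • Finsupp.single ((ν : L ≃ₗ[ℤ] L) α) (fockMap (ν : L ≃ₗ[ℤ] L) u) :=
  twist_single _ _ _ _

/-- The automorphism `e^{h(0)}`, which acts on `M(1) ⊗ 𝔢_α` as multiplication by
`e^⟨h,α⟩`. -/
def expZero {L : Type*} [AddCommGroup L] [Module.Free ℤ L] [Module.Finite ℤ L]
    (B : LinearMap.BilinForm ℤ L) (ε : L → L → ℤˣ) (h : Cartan L) : Aut B ε :=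
  ⟨twist 1 fun α => Units.mk0 (Complex.exp (formC B h (toCartan α))) (Complex.exp_ne_zero _),
    twist_mem_aut (one_mem _) fun α β => by
      have : toCartan (α + β) = toCartan α + toCartan β := by
        simp [toCartan, TensorProduct.tmul_add]
      simp [this, Complex.exp_add]
      ring⟩

lemma expZero_single {L : Type*} [AddCommGroup L] [Module.Free ℤ L] [Module.Finite ℤ L]
    (B : LinearMap.BilinForm ℤ L) (ε : L → L → ℤˣ) (h : Cartan L) (α : L) (u : Fock L) :
    (expZero B ε h : Space L ≃ₗ[ℂ] Space L) (Finsupp.single α u) =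
      Complex.exp (formC B h (toCartan α)) • Finsupp.single α u := by
  have := twist_single 1
    (fun α => Units.mk0 (Complex.exp (formC B h (toCartan α))) (Complex.exp_ne_zero _)) α u
  rw [fockMap_one] at this
  exact this

/-- The operator `h(0)` on `V_L`: the zeroth mode of the vector `h(-1) ⊗ 1`. -/
def zeroMode {L : Type*} [AddCommGroup L] (B : LinearMap.BilinForm ℤ L) (ε : L → L → ℤˣ)
    (h : Cartan L) : Module.End ℂ (Space L) :=
  nthProduct B ε 0 (osc 0 h • vacuum ε)

lemma expArg_zero {L : Type*} [AddCommGroup L] : expArg (0 : L) = 0 := by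
  ext i
  
  have : (PowerSeries.mk fun _ => 0 : PowerSeries (Fock L)) = 0 := by ext; simp
  simp [expArg, toCartan, osc, this]

lemma expField_zero {L : Type*} [AddCommGroup L] (B : LinearMap.BilinForm ℤ L) (w : Fock L) :
    expField B 0 w = HahnSeries.C w := by
  have h1 : expPlus (0 : L) = 1 := by
    ext n
    rw [expPlus, expArg_zero, PowerSeries.coeff_subst' PowerSeries.HasSubst.zero',
      finsum_eq_single _ 0]
    · simp
    · intro d hd
      simp [zero_pow hd]
  have h2 : expMinus B 0 w = Polynomial.C w := by
    induction w using fock_induction with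
    | hC a => rw [AlgHom.commutes, Polynomial.algebraMap_apply]
    | hosc n h => rw [expMinus_osc]; simp [toCartan]
    | hmul v w hv hw => rw [map_mul, map_mul, hv, hw]
    | hadd v w hv hw => rw [map_add, map_add, hv, hw]
  change HahnSeries.ofPowerSeries ℤ (Fock L) (expPlus 0) * evalInv L (expMinus B 0 w) = _
  rw [h1, h2, map_one, one_mul, evalInv, Polynomial.lsum_apply, Polynomial.sum_C_index]
  · rfl
  · exact map_zero _

lemma annih_coeff_zero {L : Type*} [AddCommGroup L] (B : LinearMap.BilinForm ℤ L)
    (h : Cartan L) (w : Fock L) : (annih B h w).coeff 0 = 0 := by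
  induction w using fock_induction with
  | hC a => simp [annih_algebraMap]
  | hosc n k => rw [annih_ι, Polynomial.coeff_monomial, if_neg (Nat.succ_ne_zero n)]
  | hmul v w hv hw =>
    rw [annih_mul, Polynomial.coeff_add, Polynomial.coeff_smul, Polynomial.coeff_smul, hv, hw,
      smul_zero, smul_zero, add_zero]
  | hadd v w hv hw => rw [map_add, Polynomial.coeff_add, hv, hw, add_zero]

lemma ofPowerSeries_coeff_neg {L : Type*} [AddCommGroup L] (q : PowerSeries (Fock L)) {n : ℤ}
    (hn : n < 0) : (HahnSeries.ofPowerSeries ℤ (Fock L) q).coeff n = 0 := by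
  rw [HahnSeries.ofPowerSeries_apply]
  apply HahnSeries.embDomain_of_notMem_range
  rintro ⟨m, hm⟩
  have : (m : ℤ) = n := hm
  omega

lemma wt_mul_C_coeff {L : Type*} [AddCommGroup L] (i : ℕ) (u : Fock L) :
    (wt L 0 i * HahnSeries.C u).coeff (-1) = if i = 0 then u else 0 := by
  rw [wt, HahnSeries.C_apply, HahnSeries.single_mul_single, HahnSeries.coeff_single]
  by_cases hi : i = 0
  · subst hi
    simp
  · rw [if_neg hi, if_neg]
    omega

lemma zeroMode_single {L : Type*} [AddCommGroup L] (B : LinearMap.BilinForm ℤ L)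
    {ε : L → L → ℤˣ} (hε : IsLatticeCocycle B ε) (h : Cartan L) (α : L) (u : Fock L) :
    zeroMode B ε h (Finsupp.single α u) =
      formC B h (toCartan α) • Finsupp.single α u := by
  have hε1 : ((ε 0 0 : ℤ) : ℂ) * ((ε 0 α : ℤ) : ℂ) = 1 := by
    have h1 := hε.cocycle 0 0 α
    rw [add_zero, zero_add] at h1
    have h2 : ε 0 0 = ε 0 α := mul_right_cancel h1
    rw [← h2, ← Int.cast_mul, ← Units.val_mul, Int.units_mul_self]
    simp
  have hv : osc 0 h • vacuum ε = ((ε 0 0 : ℤ) : ℂ) • Finsupp.single (0 : L) (osc 0 h) := by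
    rw [vacuum, Finsupp.smul_single, Finsupp.smul_single, smul_eq_mul, Algebra.smul_def, mul_comm,
      map_intCast]
  have hF : (fockVertex B 0 α (osc 0 h) u).coeff (-1) = formC B h (toCartan α) • u := by
    obtain ⟨N, hN⟩ := (annPart_eventually 0 (expField B 0) (annih B h u)).exists
    change (symLift (A := Module.End ℂ (FockField L)) (normalOrd B α) (normalOrd_comm B α)
      (osc 0 h) (expField B 0) u).coeff (-1) = _
    rw [osc, symLift_ι, normalOrd, Finsupp.lsum_single]
    change (HahnSeries.ofPowerSeries ℤ (Fock L) (creation 0 h) * expField B 0 u +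
      formC B h (toCartan α) • (wt L 0 0 * expField B 0 u) +
      annPart 0 (expField B 0) (annih B h u)).coeff (-1) = _
    rw [hN]
    simp only [expField_zero]
    rw [HahnSeries.coeff_add, HahnSeries.coeff_add, HahnSeries.coeff_smul, wt_mul_C_coeff,
      if_pos rfl, mul_comm, HahnSeries.C_mul_eq_smul, HahnSeries.coeff_smul,
      ofPowerSeries_coeff_neg _ (by norm_num), smul_zero, zero_add, add_eq_left,
      ← HahnSeries.coeff.addMonoidHom_apply, map_sum]
    refine Finset.sum_eq_zero fun i _ => ?_
    rw [HahnSeries.coeff.addMonoidHom_apply, wt_mul_C_coeff]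
    split_ifs with hi
    · rw [hi, annih_coeff_zero]
    · rfl
  rw [zeroMode, hv, map_smul, LinearMap.smul_apply, nthProduct_single, map_zero,
    LinearMap.zero_apply, sub_zero, neg_zero, zero_sub, hF, smul_smul, hε1, one_smul, zero_add,
    Finsupp.smul_single]

/-- `e^{h(0)} v = ∑ₙ h(0)^n v / n!`, where the series converges when paired with any linear form
on `V_L`. -/
lemma expZero_hasSum {L : Type*} [AddCommGroup L] [Module.Free ℤ L] [Module.Finite ℤ L]
    (B : LinearMap.BilinForm ℤ L) {ε : L → L → ℤˣ} (hε : IsLatticeCocycle B ε) (h : Cartan L)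
    (v : Space L) (f : Space L →ₗ[ℂ] ℂ) :
    HasSum (fun n : ℕ => (n.factorial : ℂ)⁻¹ * f ((zeroMode B ε h ^ n) v))
      (f ((expZero B ε h : Space L ≃ₗ[ℂ] Space L) v)) := by
  induction v using Finsupp.induction_linear with
  | zero => simp
  | add v w hv hw => simpa [mul_add] using hv.add hw
  | single α u =>
    have key (n : ℕ) : (zeroMode B ε h ^ n) (Finsupp.single α u) =
        formC B h (toCartan α) ^ n • Finsupp.single α u := by
      induction n with
      | zero => simp
      | succ n ih =>
        rw [pow_succ, Module.End.mul_apply, zeroMode_single B hε, map_smul, ih, smul_smul,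
          pow_succ, mul_comm]
    simp only [expZero_single, key, map_smul, smul_eq_mul]
    have := (NormedSpace.expSeries_div_hasSum_exp (formC B h (toCartan α))).mul_right
      (f (Finsupp.single α u))
    rw [← Complex.exp_eq_exp_ℂ] at this
    refine this.congr_fun fun n => ?_
    ring

/-- The automorphism `g` of `V_L` is a standard lift of `ν`. -/
def IsStandardLift {L : Type*} [AddCommGroup L] [Module.Free ℤ L] [Module.Finite ℤ L]
    (B : LinearMap.BilinForm ℤ L) (ε : L → L → ℤˣ) (ν : isometryGroup B) (g : Aut B ε) : Prop :=
  ∃ (η : L → ℤˣ) (hη : IsLift ε (ν : L ≃ₗ[ℤ] L) η),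
    IsStandard (ν : L ≃ₗ[ℤ] L) η ∧ g = lift B ε ν η hη

/-- The automorphism `e^{-2πi h(0)}` of `V_L`. -/
def innerAut {L : Type*} [AddCommGroup L] [Module.Free ℤ L] [Module.Finite ℤ L]
    (B : LinearMap.BilinForm ℤ L) (ε : L → L → ℤˣ) (h : Cartan L) : Aut B ε :=
  expZero B ε (-(2 * (Real.pi : ℂ) * Complex.I) • h)

end
end LatticeVOA

namespace LatticeVOA

/-! ### The form of a positive-definite lattice -/

section Form

variable {L : Type*} [AddCommGroup L] {B : LinearMap.BilinForm ℤ L}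

/-! Write m for the order of ν. Every automorphism in question sends u ⊗ 𝔢_α to c(α) ν(u) ⊗ 𝔢_{να},
so its order is read off from ν and from products of c along ν-orbits (`ActsAs.pow`,
`ActsAs.eq_one_iff`). In particular m divides its order, and equality means exactly that the m-th
power is trivial.

The m-th power of the standard lift multiplies M(1) ⊗ 𝔢_α by a sign χ(α) = ∏ η(ν^i α) over i < m.
Since ν^m = 1, χ is a character of L with values ±1, so the lift has order m if χ = 1 and 2m
otherwise. For h fixed by ν, the number ⟨h, α⟩ is constant on ν-orbits, so the m-th power of the
lift times e^{-2πi h(0)} acts by χ(α) e^{-2πi m⟨h, α⟩}. The order is therefore m if and only if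
e^{2πi m⟨h, α⟩} = χ(α) for all α (`orderOf_lift_mul_innerAut_eq_iff`). If χ = 1 this says that mh
pairs integrally with L. In general, dividing the conditions for h and for one solution s leaves the
same statement for h - s.

It remains to find s when χ ≠ 1. Standardness enters through the formula χ(α) = (-1)^⟨α, Sα⟩ with Sα
= ∑ ν^i α (`liftSign_eq`), obtained by comparing products in the twisted group algebra. Hence χ is
trivial on the kernel of S and descends to the free group S(L). Lifting it to ℤ on a basis of S(L),
with values 0 and 1, gives a ν-invariant integral form f with χ = (-1)^f that takes the value 1
(`exists_linearForm`). The form is represented by some x in (L')^ν, and s = x/(2m) works: e^{2πi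
m⟨s, α⟩} = (-1)^{f(α)}, while the value 1 of f makes the order of e^{-2πi s(0)} exactly 2m.

Positive definiteness supplies nondegeneracy, hence the representing vectors, and the finiteness of
O(L), hence m > 0. -/

lemma eq_zero_of_forall_form_eq_zero (hpos : ∀ α, α ≠ 0 → 0 < B α α) {x : L}
    (hx : ∀ y, B x y = 0) : x = 0 := by
  by_contra h
  exact (hpos x h).ne' (hx x)

/-- Up to a nonzero integer factor, every integral linear form is represented by a vector. -/
lemma exists_forall_form_eq_mul [Module.Free ℤ L] [Module.Finite ℤ L]
    (hsymm : ∀ α β, B α β = B β α) (hpos : ∀ α, α ≠ 0 → 0 < B α α) :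
    ∃ d : ℤ, d ≠ 0 ∧ ∀ f : L →ₗ[ℤ] ℤ, ∃ x, ∀ y, B x y = d * f y := by
  classical
  let b := Module.Free.chooseBasis ℤ L
  let G := LinearMap.BilinForm.toMatrix b B
  have hnd : B.Nondegenerate := by
    refine ⟨fun x hx => eq_zero_of_forall_form_eq_zero hpos hx, fun x hx => ?_⟩
    exact eq_zero_of_forall_form_eq_zero hpos fun y => (hsymm x y).trans (hx y)
  have hG : G.det ≠ 0 := (LinearMap.BilinForm.nondegenerate_iff_det_ne_zero b).1 hnd
  -- With φ the row vector of values of f on the basis, the coefficients φ · adj(G) solve the system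
  -- because adj(G) · G = det G. The inverse Gram matrix is avoided, so the vector stays in L.
  refine ⟨G.det, hG, fun f => ⟨∑ i, Matrix.vecMul (fun j => f (b j)) G.adjugate i • b i, ?_⟩⟩
  have key : B (∑ i, Matrix.vecMul (fun j => f (b j)) G.adjugate i • b i) = G.det • f := by
    refine b.ext fun k => ?_
    have h1 : Matrix.vecMul (Matrix.vecMul (fun j => f (b j)) G.adjugate) G k =
        G.det * f (b k) := by
      rw [Matrix.vecMul_vecMul, Matrix.adjugate_mul, Matrix.vecMul_smul, Matrix.vecMul_one]
      rfl
    rw [LinearMap.smul_apply, smul_eq_mul, ← h1, map_sum, LinearMap.sum_apply]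
    refine Finset.sum_congr rfl fun i _ => ?_
    rw [map_smul, LinearMap.smul_apply, smul_eq_mul]
    rw [show B (b i) (b k) = G i k from (LinearMap.BilinForm.toMatrix_apply b B i k).symm]
  intro y
  rw [key]
  rfl

/-- The isometry group of a positive-definite lattice is finite. -/
lemma finite_isometryGroup [Module.Free ℤ L] [Module.Finite ℤ L]
    (hsymm : ∀ α β, B α β = B β α) (hpos : ∀ α, α ≠ 0 → 0 < B α α) :
    Finite (isometryGroup B) := by
  let b := Module.Free.chooseBasis ℤ L
  have hnn (x : L) : 0 ≤ B x x := by
    by_cases hx : x = 0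
    · simp [hx]
    · exact (hpos x hx).le
  have hbound (μ : isometryGroup B) (i j : Module.Free.ChooseBasisIndex ℤ L) :
      B ((μ : L ≃ₗ[ℤ] L) (b i)) (b j) ∈
        Set.Icc (-(B (b i) (b i) * B (b j) (b j))) (B (b i) (b i) * B (b j) (b j)) := by
    -- Cauchy–Schwarz, together with the invariance of the norm of `b i` under μ, bounds every
    -- matrix entry of μ independently of μ.
    have h := LinearMap.BilinForm.apply_sq_le_of_symm B hnn ⟨fun x y => hsymm x y⟩
      ((μ : L ≃ₗ[ℤ] L) (b i)) (b j)
    rw [μ.2 (b i) (b i)] at h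
    rw [Set.mem_Icc, ← abs_le]
    -- The bound is on the square; for integers |n| ≤ n², so it also bounds |n|.
    refine le_trans ?_ h
    rw [← sq_abs]
    exact Int.le_self_sq _
  let F (μ : isometryGroup B) : ∀ i j : Module.Free.ChooseBasisIndex ℤ L,
      Set.Icc (-(B (b i) (b i) * B (b j) (b j))) (B (b i) (b i) * B (b j) (b j)) :=
    fun i j => ⟨_, hbound μ i j⟩
  refine Finite.of_injective F fun μ μ' h => ?_
  refine Subtype.ext (LinearEquiv.toLinearMap_injective (b.ext fun i => ?_))
  rw [← sub_eq_zero]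
  refine eq_zero_of_forall_form_eq_zero hpos fun y => ?_
  rw [map_sub, LinearMap.sub_apply, sub_eq_zero]
  refine congrArg (fun f => f y) (b.ext (f₁ := B _) (f₂ := B _) fun j => ?_)
  exact congrArg Subtype.val (congrFun (congrFun h i) j)

/-! ### Scalar extension to ℚ and ℂ, and the dual lattice -/

lemma toCartan_add (α β : L) : toCartan (α + β) = toCartan α + toCartan β :=
  TensorProduct.tmul_add _ _ _

lemma ratToCartan_tmul (q : ℚ) (α : L) : ratToCartan L (q ⊗ₜ[ℤ] α) = (q : ℂ) ⊗ₜ[ℤ] α :=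
  rfl

lemma formC_ratToCartan (x : ℚ ⊗[ℤ] L) (β : L) :
    formC B (ratToCartan L x) (toCartan β) =
      ((B.baseChange ℚ x ((1 : ℚ) ⊗ₜ[ℤ] β) : ℚ) : ℂ) := by
  induction x using TensorProduct.induction_on with
  | zero => simp
  | add x y hx hy => simp only [map_add, LinearMap.add_apply, hx, hy, Rat.cast_add]
  | tmul q α => rw [ratToCartan_tmul]; simp [toCartan]

lemma ratToCartan_injective [Module.Free ℤ L] : Function.Injective (ratToCartan L) :=
  Module.Flat.rTensor_preserves_injective_linearMap _ (algebraMap ℚ ℂ).injective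

lemma ratToCartan_baseChange (ν : L ≃ₗ[ℤ] L) (x : ℚ ⊗[ℤ] L) :
    ratToCartan L ((ν : L →ₗ[ℤ] L).baseChange ℚ x) = extC ν (ratToCartan L x) := by
  induction x using TensorProduct.induction_on with
  | zero => simp
  | add x y hx hy => simp only [map_add, hx, hy]
  | tmul q α => simp [ratToCartan_tmul, extC]

/-- Positivity cannot be applied directly, since the complex bilinear form has isotropic vectors.
Instead each coordinate of h, multiplied by the nonzero integer d, is the pairing of h with a
lattice vector that represents d times the coordinate form. -/
lemma eq_zero_of_forall_formC_eq_zero [Module.Free ℤ L] [Module.Finite ℤ L]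
    (hsymm : ∀ α β, B α β = B β α) (hpos : ∀ α, α ≠ 0 → 0 < B α α) {h : Cartan L}
    (hh : ∀ β, formC B h (toCartan β) = 0) : h = 0 := by
  obtain ⟨d, hd, hrep⟩ := exists_forall_form_eq_mul hsymm hpos
  let b := Module.Free.chooseBasis ℤ L
  let c := b.baseChange ℂ
  have hcoord (f : L →ₗ[ℤ] ℤ) (x : L) (hx : ∀ y, B x y = d * f y) (k : Cartan L) :
      formC B k (toCartan x) = d * TensorProduct.rid ℤ ℂ (LinearMap.lTensor ℂ f k) := by
    induction k using TensorProduct.induction_on with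
    | zero => simp
    | add y z hy hz => simp only [map_add, LinearMap.add_apply, hy, hz, mul_add]
    | tmul a α =>
      simp [toCartan, hsymm α x, hx]
      ring
  refine c.ext_elem fun i => ?_
  obtain ⟨x, hx⟩ := hrep (b.coord i)
  have h1 := hcoord _ x hx h
  rw [hh] at h1
  have h2 : TensorProduct.rid ℤ ℂ (LinearMap.lTensor ℂ (b.coord i) h) = c.repr h i := by
    clear h1 hh
    induction h using TensorProduct.induction_on with
    | zero => simp
    | add y z hy hz => simp only [map_add, hy, hz, Finsupp.add_apply]
    | tmul a α => simp [c, mul_comm]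
  rw [h2] at h1
  simpa [hd] using h1

/-- An element of `𝔥` pairing integrally with `L` comes from the dual lattice. -/
lemma exists_dualLattice [Module.Free ℤ L] [Module.Finite ℤ L]
    (hsymm : ∀ α β, B α β = B β α) (hpos : ∀ α, α ≠ 0 → 0 < B α α) (f : L →ₗ[ℤ] ℤ) :
    ∃ x ∈ dualLattice B, ∀ β, formC B (ratToCartan L x) (toCartan β) = f β := by
  obtain ⟨d, hd, hrep⟩ := exists_forall_form_eq_mul hsymm hpos
  obtain ⟨x, hx⟩ := hrep f
  -- The lattice vector x represents only d · f; dividing by d leaves L but stays in L ⊗ ℚ.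
  have key (β : L) : B.baseChange ℚ ((d : ℚ)⁻¹ ⊗ₜ[ℤ] x) ((1 : ℚ) ⊗ₜ[ℤ] β) = f β := by
    have hd' : (d : ℚ) ≠ 0 := by exact_mod_cast hd
    simp only [LinearMap.BilinForm.baseChange_tmul, hx]
    simp [mul_comm, hd']
  exact ⟨(d : ℚ)⁻¹ ⊗ₜ[ℤ] x, fun β => ⟨f β, key β⟩, fun β => by
    rw [formC_ratToCartan, key]; simp⟩

lemma eq_of_forall_formC_eq [Module.Free ℤ L] [Module.Finite ℤ L]
    (hsymm : ∀ α β, B α β = B β α) (hpos : ∀ α, α ≠ 0 → 0 < B α α) {h k : Cartan L}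
    (hhk : ∀ β, formC B h (toCartan β) = formC B k (toCartan β)) : h = k := by
  rw [← sub_eq_zero]
  refine eq_zero_of_forall_formC_eq_zero hsymm hpos fun β => ?_
  rw [map_sub, LinearMap.sub_apply, hhk, sub_self]

/-- The elements of `(L')^ν` are the elements of `𝔥^ν` that pair integrally with `L`. -/
lemma mem_dualFixed_iff [Module.Free ℤ L] [Module.Finite ℤ L]
    (hsymm : ∀ α β, B α β = B β α) (hpos : ∀ α, α ≠ 0 → 0 < B α α) (ν : L ≃ₗ[ℤ] L)
    {h : Cartan L} :
    h ∈ dualFixed B ν ↔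
      h ∈ fixedCartan ν ∧ ∀ β, ∃ k : ℤ, formC B h (toCartan β) = k := by
  constructor
  · rintro ⟨x, ⟨hx, hνx⟩, rfl⟩
    refine ⟨?_, fun β => ?_⟩
    · change extC ν (ratToCartan L x) = ratToCartan L x
      rw [← ratToCartan_baseChange, hνx]
    · obtain ⟨k, hk⟩ := hx β
      exact ⟨k, by rw [formC_ratToCartan, hk]; simp⟩
  · rintro ⟨hfix, hint⟩
    choose f hf using hint
    -- The integers `f β` are chosen one β at a time, but they are determined by their images in ℂ,
    -- so f is additive.
    obtain ⟨x, hx, hxf⟩ := exists_dualLattice hsymm hpos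
      (AddMonoidHom.toIntLinearMap (AddMonoidHom.mk' f fun α β => by
        have : ((f (α + β) : ℤ) : ℂ) = ((f α + f β : ℤ) : ℂ) := by
          rw [Int.cast_add, ← hf, ← hf, ← hf, toCartan_add, map_add]
        exact_mod_cast this))
    have hxh : ratToCartan L x = h := eq_of_forall_formC_eq hsymm hpos fun β => by
      rw [hxf, hf]
      rfl
    -- Invariance under ν is known in 𝔥 and descends to L ⊗ ℚ because L ⊗ ℚ embeds in 𝔥.
    refine ⟨x, ⟨hx, ratToCartan_injective ?_⟩, hxh⟩
    rw [ratToCartan_baseChange, hxh]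
    exact hfix

/-- From ⟨h, να⟩ = ⟨νh, να⟩ = ⟨h, α⟩. This makes the scalar of e^{-2πi h(0)} constant along
ν-orbits. -/
lemma formC_fixed {ν : L ≃ₗ[ℤ] L} (hν : ν ∈ isometryGroup B) {h : Cartan L}
    (hh : h ∈ fixedCartan ν) (α : L) :
    formC B h (toCartan (ν α)) = formC B h (toCartan α) := by
  have hh' : extC ν h = h := hh
  nth_rw 1 [← hh']
  rw [← extC_toCartan, formC_extC hν]

/-- A `ν`-invariant linear form on `L` is represented by an element of `(L')^ν`. -/
lemma exists_dualFixed [Module.Free ℤ L] [Module.Finite ℤ L]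
    (hsymm : ∀ α β, B α β = B β α) (hpos : ∀ α, α ≠ 0 → 0 < B α α) {ν : L ≃ₗ[ℤ] L}
    (hν : ν ∈ isometryGroup B) (f : L →ₗ[ℤ] ℤ) (hf : ∀ α, f (ν α) = f α) :
    ∃ x ∈ dualFixed B ν, ∀ β, formC B x (toCartan β) = f β := by
  obtain ⟨x, -, hx⟩ := exists_dualLattice hsymm hpos f
  refine ⟨ratToCartan L x, (mem_dualFixed_iff hsymm hpos ν).2 ⟨?_, fun β => ⟨_, hx β⟩⟩, hx⟩
  refine eq_of_forall_formC_eq hsymm hpos fun β => ?_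
  -- Testing against νβ lets the isometry cancel on the side of νx; invariance of f does the rest.
  obtain ⟨β, rfl⟩ := ν.surjective β
  rw [← extC_toCartan, formC_extC hν, extC_toCartan, LinearMap.id_apply, hx, hx, hf]

end Form

/-! ### The sign of the `m`-th power of a standard lift -/

section Sign

variable {L : Type*} [AddCommGroup L] {B : LinearMap.BilinForm ℤ L} {ε : L → L → ℤˣ}
  {ν : L ≃ₗ[ℤ] L} {η : L → ℤˣ}

/-- `∑_{i < k} ν^i α`. -/
def orbitSum (ν : L ≃ₗ[ℤ] L) (k : ℕ) : L →ₗ[ℤ] L :=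
  ∑ i ∈ Finset.range k, ((ν ^ i : L ≃ₗ[ℤ] L) : L →ₗ[ℤ] L)

lemma orbitSum_apply (ν : L ≃ₗ[ℤ] L) (k : ℕ) (α : L) :
    orbitSum ν k α = ∑ i ∈ Finset.range k, (ν ^ i) α := by
  simp [orbitSum]

lemma orbitSum_succ (ν : L ≃ₗ[ℤ] L) (k : ℕ) (α : L) :
    orbitSum ν (k + 1) α = orbitSum ν k α + (ν ^ k) α := by
  simp only [orbitSum_apply, Finset.sum_range_succ]

lemma pow_succ_apply (ν : L ≃ₗ[ℤ] L) (k : ℕ) (α : L) : (ν ^ (k + 1)) α = ν ((ν ^ k) α) := by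
  rw [pow_succ', LinearEquiv.mul_apply]

lemma orbitSum_map (ν : L ≃ₗ[ℤ] L) (k : ℕ) (α : L) :
    orbitSum ν k (ν α) = ν (orbitSum ν k α) := by
  simp only [orbitSum_apply, map_sum]
  refine Finset.sum_congr rfl fun i _ => ?_
  rw [← LinearEquiv.mul_apply, ← pow_succ, pow_succ_apply]

lemma add_map_orbitSum (ν : L ≃ₗ[ℤ] L) (k : ℕ) (α : L) :
    α + ν (orbitSum ν k α) = orbitSum ν (k + 1) α := by
  simp only [orbitSum_apply, Finset.sum_range_succ', map_sum, pow_succ_apply, pow_zero,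
    LinearEquiv.coe_one, id_eq]
  rw [add_comm]

/-- Both α + ν(S_k α) and S_k α + ν^k α equal S_{k+1} α. Full orbit sums are thus fixed by ν, which
is where the standardness of η can be applied. -/
lemma map_orbitSum_of_pow_eq_one {k : ℕ} (hk : ν ^ k = 1) (α : L) :
    ν (orbitSum ν k α) = orbitSum ν k α := by
  have h := add_map_orbitSum ν k α
  rw [orbitSum_succ, hk, LinearEquiv.coe_one, id_eq, add_comm] at h
  exact add_right_cancel h

/-- The sign `∏_{i < k} η(ν^i α)` by which the `k`-th power of the lift acts on `𝔢_α`. -/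
def liftSign (ν : L ≃ₗ[ℤ] L) (η : L → ℤˣ) (k : ℕ) (α : L) : ℤˣ :=
  ∏ i ∈ Finset.range k, η ((ν ^ i) α)

lemma liftSign_succ (ν : L ≃ₗ[ℤ] L) (η : L → ℤˣ) (k : ℕ) (α : L) :
    liftSign ν η (k + 1) α = liftSign ν η k α * η ((ν ^ k) α) :=
  Finset.prod_range_succ _ _

lemma IsLift.add_eq (hη : IsLift ε ν η) (α β : L) :
    η (α + β) = η α * η β * (ε (ν α) (ν β) * ε α β) := by
  have h := hη α β
  rw [div_eq_div_iff_mul_eq_mul] at h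
  rw [← mul_assoc, h, mul_right_comm, Int.units_mul_self, one_mul]

/-- The coboundary relations of η at (ν^i α, ν^i β) telescope: all intermediate values of ε occur
twice and cancel as signs, leaving only the two ends. -/
lemma liftSign_add_eq (hη : IsLift ε ν η) (k : ℕ) (α β : L) :
    liftSign ν η k (α + β) = liftSign ν η k α * liftSign ν η k β *
      (ε ((ν ^ k) α) ((ν ^ k) β) * ε α β) := by
  induction k with
  | zero => simp [liftSign, Int.units_mul_self]
  | succ k ih =>
    rw [liftSign_succ, liftSign_succ, liftSign_succ, ih, map_add, hη.add_eq, pow_succ_apply,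
      pow_succ_apply]
    have h := Int.units_mul_self (ε ((ν ^ k) α) ((ν ^ k) β))
    generalize ε ((ν ^ k) α) ((ν ^ k) β) = x at h ⊢
    calc _ = x * x * (liftSign ν η k α * η ((ν ^ k) α) * (liftSign ν η k β * η ((ν ^ k) β)) *
          (ε (ν ((ν ^ k) α)) (ν ((ν ^ k) β)) * ε α β)) := by
          simp only [mul_assoc, mul_comm, mul_left_comm]
      _ = _ := by rw [h, one_mul]

/-- The `m`-th power of a lift acts on the `𝔢_α` by a character if `ν^m = 1`. -/
lemma liftSign_add (hη : IsLift ε ν η) {m : ℕ} (hm : ν ^ m = 1) (α β : L) :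
    liftSign ν η m (α + β) = liftSign ν η m α * liftSign ν η m β := by
  rw [liftSign_add_eq hη, hm, LinearEquiv.coe_one, id_eq, id_eq, Int.units_mul_self, mul_one]

lemma IsLatticeCocycle.comm_of_form_eq_zero (hε : IsLatticeCocycle B ε) {α β : L}
    (h : B α β = 0) : ε α β = ε β α := by
  have := hε.comm α β
  rwa [h, zpow_zero, div_eq_one] at this

/-- The two ways of comparing `𝔢_α 𝔢_{να} ⋯ 𝔢_{ν^k α}` with its image under the lift. -/
lemma eta_orbitSum_mul (hε : IsLatticeCocycle B ε) (hη : IsLift ε ν η) (hst : IsStandard ν η)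
    (k : ℕ) (α : L) :
    η (orbitSum ν k α) * ε α (ν (orbitSum ν k α)) =
      liftSign ν η k α * ε (orbitSum ν k α) ((ν ^ k) α) := by
  induction k with
  | zero =>
    have h0 : η 0 = 1 := hst 0 (map_zero ν)
    simp only [orbitSum_apply, liftSign, Finset.range_zero, Finset.sum_empty, Finset.prod_empty,
      pow_zero, LinearEquiv.coe_one, id_eq, map_zero, h0, one_mul]
    -- What is left is ε(α, 0) = ε(0, α). As ε need not be normalised, this is taken from the
    -- commutator relation with ⟨α, 0⟩ = 0.
    exact hε.comm_of_form_eq_zero (map_zero _)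
  | succ k ih =>
    -- Let P_k = 𝔢_α 𝔢_{να} ⋯ 𝔢_{ν^{k-1}α}, a multiple of 𝔢_{S_k α}. The claim expresses 𝔢_α ν̂(P_k)
    -- = χ_k(α) P_k 𝔢_{ν^k α}, with χ_k the sign `liftSign ν η k`; the cocycle identity is the
    -- associativity needed to append one more factor.
    have hc := hε.cocycle α (ν (orbitSum ν k α)) (ν ((ν ^ k) α))
    rw [add_map_orbitSum] at hc
    rw [liftSign_succ]
    nth_rw 1 [orbitSum_succ]
    nth_rw 1 [orbitSum_succ]
    rw [hη.add_eq, map_add, pow_succ_apply]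
    have h := Int.units_mul_self (ε (orbitSum ν k α) ((ν ^ k) α))
    generalize ε (orbitSum ν k α) ((ν ^ k) α) = x at h ih ⊢
    set S := orbitSum ν k α
    set S' := orbitSum ν (k + 1) α
    set β := (ν ^ k) α
    calc _ = η S * η β * x * (ε (ν S) (ν β) * ε α (ν S + ν β)) := by
          simp only [mul_comm, mul_left_comm]
      _ = (η S * ε α (ν S)) * (η β * x * ε S' (ν β)) := by
          rw [← hc]
          simp only [mul_comm, mul_left_comm]
      _ = x * x * (liftSign ν η k α * η β * ε S' (ν β)) := by
          rw [ih]
          simp only [mul_assoc, mul_comm, mul_left_comm]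
      _ = _ := by rw [h, one_mul]

/-- The `m`-th power of a standard lift acts on `𝔢_α` by `(-1)^⟨α, ∑_{i < m} ν^i α⟩`. -/
lemma liftSign_eq (hε : IsLatticeCocycle B ε) (hη : IsLift ε ν η) (hst : IsStandard ν η)
    {m : ℕ} (hm : ν ^ m = 1) (α : L) :
    liftSign ν η m α = (-1) ^ (B α (orbitSum ν m α)) := by
  have h := eta_orbitSum_mul hε hη hst m α
  -- For k = m the vector S = S_m α is fixed, so η(S) = 1, and ν^m α = α. The comparison becomes
  -- ε(α, S) = χ(α) ε(S, α), a commutator in the twisted group algebra.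
  have hfix := map_orbitSum_of_pow_eq_one hm α
  rw [hfix, hst _ hfix, one_mul, hm, LinearEquiv.coe_one, id_eq] at h
  rw [← hε.comm, h, mul_div_cancel_right]

/-- There is a `ν`-invariant linear form whose reduction modulo `2` describes the `m`-th power of
a standard lift, and which takes the value `1` unless this power is trivial. -/
lemma exists_linearForm [Module.Free ℤ L] [Module.Finite ℤ L] (hε : IsLatticeCocycle B ε)
    (hη : IsLift ε ν η) (hst : IsStandard ν η) {m : ℕ} (hm : ν ^ m = 1) :
    ∃ f : L →ₗ[ℤ] ℤ, (∀ α, f (ν α) = f α) ∧ (∀ α, liftSign ν η m α = (-1) ^ f α) ∧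
      ((∃ α, liftSign ν η m α ≠ 1) → ∃ α, f α = 1) := by
  classical
  let χ : L →+ Additive ℤˣ := AddMonoidHom.mk' (fun α => Additive.ofMul (liftSign ν η m α))
    fun α β => liftSign_add hη hm α β
  -- By the explicit formula, χ is trivial on the kernel of the orbit sum, hence depends only on the
  -- image in N.
  have hχ (α : L) (h : orbitSum ν m α = 0) : χ α = 0 := by
    change liftSign ν η m α = 1
    rw [liftSign_eq hε hη hst hm, h, map_zero, zpow_zero]
  let N := LinearMap.range (orbitSum ν m)
  let b := Module.Free.chooseBasis ℤ N
  have hpre (i) : ∃ α, orbitSum ν m α = b i := (b i).2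
  choose a ha using hpre
  -- N is free as a subgroup of L. Choosing the odd lift to be exactly 1 is what later forces f to
  -- take the value 1.
  let g : N →ₗ[ℤ] ℤ := b.constr ℤ fun i => if liftSign ν η m (a i) = 1 then 0 else 1
  -- A linear section of the orbit sum. Since α and σ(Sα) have the same orbit sum, χ agrees on them,
  -- and the check of χ = (-1)^f reduces to the basis of N.
  let σ : N →ₗ[ℤ] L := b.constr ℤ a
  let f : L →ₗ[ℤ] ℤ := g ∘ₗ (orbitSum ν m).rangeRestrict
  have hσ (x : N) : orbitSum ν m (σ x) = x := by
    refine congrArg (fun φ => φ x) (b.ext (f₁ := orbitSum ν m ∘ₗ σ) (f₂ := N.subtype) fun i => ?_)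
    simp [σ, ha]
  have hfa (i) : f (a i) = if liftSign ν η m (a i) = 1 then 0 else 1 := by
    have : (orbitSum ν m).rangeRestrict (a i) = b i := Subtype.ext (ha i)
    rw [LinearMap.comp_apply, this, Module.Basis.constr_basis]
  let ψ : ℤ →+ Additive ℤˣ := (zmultiplesHom _) (Additive.ofMul (-1))
  have hψ (n : ℤ) : ψ n = Additive.ofMul ((-1 : ℤˣ) ^ n) := rfl
  have hgσ (x : N) : χ (σ x) = ψ (g x) := by
    refine congrArg (fun φ => φ x) (b.ext (f₁ := χ.toIntLinearMap ∘ₗ σ)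
      (f₂ := ψ.toIntLinearMap ∘ₗ g) fun i => ?_)
    simp only [LinearMap.comp_apply, AddMonoidHom.coe_toIntLinearMap, σ, g,
      Module.Basis.constr_basis, hψ]
    change Additive.ofMul (liftSign ν η m (a i)) = _
    rcases Int.units_eq_one_or (liftSign ν η m (a i)) with h | h <;> simp [h]
  have hmain (α : L) : liftSign ν η m α = (-1) ^ f α := by
    have h1 : χ α = χ (σ ((orbitSum ν m).rangeRestrict α)) := by
      rw [← sub_eq_zero, ← map_sub]
      refine hχ _ ?_
      rw [map_sub, hσ, sub_eq_zero]
      rfl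
    rw [hgσ] at h1
    exact h1
  refine ⟨f, fun α => ?_, hmain, ?_⟩
  · have : (orbitSum ν m).rangeRestrict (ν α) = (orbitSum ν m).rangeRestrict α :=
      Subtype.ext (by
        simp only [LinearMap.codRestrict_apply, LinearMap.rangeRestrict]
        rw [orbitSum_map, map_orbitSum_of_pow_eq_one hm])
    simp only [f, LinearMap.comp_apply, this]
  · rintro ⟨α, hα⟩
    by_contra! hne
    -- If f never takes the value 1, every basis value of g is the other choice, 0. Then g = 0 and χ
    -- is trivial.
    have hg : g = 0 := b.ext fun i => by
      have h1 := hfa i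
      have h2 := hne (a i)
      split_ifs at h1 with h
      · rw [Module.Basis.constr_basis, if_pos h]
        rfl
      · exact absurd h1 h2
    apply hα
    rw [hmain]
    simp [f, hg]

end Sign

/-! ### Orders of automorphisms permuting the summands `M(1) ⊗ 𝔢_α` -/

section Order

variable {L : Type*} [AddCommGroup L] [Module.Free ℤ L] [Module.Finite ℤ L]
  {B : LinearMap.BilinForm ℤ L} {ε : L → L → ℤˣ}

/-- The automorphism `g` acts by `u ⊗ 𝔢_α ↦ c(α) ν(u) ⊗ 𝔢_{να}`. -/
def ActsAs (g : Aut B ε) (ν : L ≃ₗ[ℤ] L) (c : L → ℂ) : Prop :=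
  ∀ α u, (g : Space L ≃ₗ[ℂ] Space L) (Finsupp.single α u) =
    c α • Finsupp.single (ν α) (fockMap ν u)

lemma ActsAs.mul {g g' : Aut B ε} {ν ν' : L ≃ₗ[ℤ] L} {c c' : L → ℂ} (hg : ActsAs g ν c)
    (hg' : ActsAs g' ν' c') : ActsAs (g * g') (ν * ν') fun α => c' α * c (ν' α) := by
  intro α u
  rw [Subgroup.coe_mul, LinearEquiv.mul_apply, hg', map_smul, hg, smul_smul, fockMap_mul,
    LinearEquiv.mul_apply]

lemma ActsAs.pow {g : Aut B ε} {ν : L ≃ₗ[ℤ] L} {c : L → ℂ} (hg : ActsAs g ν c) (k : ℕ) :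
    ActsAs (g ^ k) (ν ^ k) fun α => ∏ i ∈ Finset.range k, c ((ν ^ i) α) := by
  induction k with
  | zero =>
    intro α u
    simp [fockMap_one]
  | succ k ih =>
    rw [pow_succ' g, pow_succ' ν]
    simpa only [Finset.prod_range_succ] using hg.mul ih

/-- Evaluation at 1 ⊗ 𝔢_α recovers both να and c(α), because 1 is nonzero in the Fock space and
fixed by ν. -/
lemma ActsAs.eq_one_iff {g : Aut B ε} {ν : L ≃ₗ[ℤ] L} {c : L → ℂ} (hg : ActsAs g ν c) :
    g = 1 ↔ ν = 1 ∧ ∀ α, c α = 1 := by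
  constructor
  · rintro rfl
    have h (α : L) : Finsupp.single α (1 : Fock L) = Finsupp.single (ν α) (c α • 1) := by
      have := hg α 1
      rwa [map_one, Finsupp.smul_single] at this
    have hν (α : L) : ν α = α := by
      have := (Finsupp.single_eq_single_iff _ _ _ _).1 (h α)
      rcases this with h1 | h1
      · exact h1.1.symm
      · exact absurd h1.1 one_ne_zero
    refine ⟨LinearEquiv.ext hν, fun α => ?_⟩
    have h1 := h α
    rw [hν] at h1
    have h2 := Finsupp.single_injective _ h1
    rw [← Algebra.algebraMap_eq_smul_one] at h2
    exact (SymmetricAlgebra.algebraMap_eq_one_iff _ _).1 h2.symm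
  · rintro ⟨rfl, h⟩
    refine Subtype.ext (LinearEquiv.toLinearMap_injective (Finsupp.lhom_ext fun α u => ?_))
    refine (hg α u).trans ?_
    rw [h, one_smul, fockMap_one]
    rfl

lemma ActsAs.orderOf_dvd {g : Aut B ε} {ν : L ≃ₗ[ℤ] L} {c : L → ℂ} (hg : ActsAs g ν c) : orderOf ν ∣ orderOf g := by
  exact orderOf_dvd_of_pow_eq_one ((hg.pow _).eq_one_iff.1 (pow_orderOf_eq_one g)).1

/-- The order of ν always divides that of g, so equality only requires that g to the power `orderOf
ν` be trivial; that power permutes no summands and is given by scalars alone. -/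
lemma ActsAs.orderOf_eq_iff {g : Aut B ε} {ν : L ≃ₗ[ℤ] L} {c : L → ℂ} (hg : ActsAs g ν c) :
    orderOf g = orderOf ν ↔ ∀ α, ∏ i ∈ Finset.range (orderOf ν), c ((ν ^ i) α) = 1 := by
  have h := (hg.pow (orderOf ν)).eq_one_iff
  rw [pow_orderOf_eq_one ν, eq_self_iff_true, true_and] at h
  rw [← h, ← orderOf_dvd_iff_pow_eq_one]
  exact ⟨fun h => h.dvd, fun h => Nat.dvd_antisymm h hg.orderOf_dvd⟩

lemma actsAs_lift (ν : isometryGroup B) (η : L → ℤˣ) (hη : IsLift ε (ν : L ≃ₗ[ℤ] L) η) :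
    ActsAs (lift B ε ν η hη) ν fun α => ((η α : ℤ) : ℂ) :=
  lift_single B ε ν η hη

lemma actsAs_innerAut (h : Cartan L) :
    ActsAs (innerAut B ε h) 1 fun α =>
      Complex.exp (-(2 * Real.pi * Complex.I * formC B h (toCartan α))) := by
  intro α u
  rw [innerAut, expZero_single, fockMap_one, map_smul, LinearMap.smul_apply, smul_eq_mul, neg_mul]
  rfl

end Order

/-! ### The order of a standard lift times an inner automorphism -/

lemma pow_orderOf_coe {L : Type*} [AddCommGroup L] {B : LinearMap.BilinForm ℤ L}
    (ν : isometryGroup B) : (ν : L ≃ₗ[ℤ] L) ^ orderOf ν = 1 := by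
  rw [← Subgroup.orderOf_coe, pow_orderOf_eq_one]

section Main

variable {L : Type*} [AddCommGroup L] [Module.Free ℤ L] [Module.Finite ℤ L]
  {B : LinearMap.BilinForm ℤ L} {ε : L → L → ℤˣ} {ν : isometryGroup B} {η : L → ℤˣ}

lemma intCast_unit_eq_one_iff (u : ℤˣ) : ((u : ℤ) : ℂ) = 1 ↔ u = 1 := by
  rw [Int.cast_eq_one, Units.val_eq_one]

lemma orderOf_lift_eq_iff (hη : IsLift ε (ν : L ≃ₗ[ℤ] L) η) :
    orderOf (lift B ε ν η hη) = orderOf ν ↔ ∀ α, liftSign (ν : L ≃ₗ[ℤ] L) η (orderOf ν) α = 1 := by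
  rw [← Subgroup.orderOf_coe ν, (actsAs_lift ν η hη).orderOf_eq_iff]
  refine forall_congr' fun α => ?_
  rw [← intCast_unit_eq_one_iff, liftSign, Units.coe_prod, Int.cast_prod]

/-- The m-th power of the lift acts by signs, so its square is trivial. The order is then a multiple
of m dividing 2m; positivity of m allows m to be cancelled. -/
lemma orderOf_lift (hν : 0 < orderOf ν) (hη : IsLift ε (ν : L ≃ₗ[ℤ] L) η) :
    orderOf (lift B ε ν η hη) = orderOf ν ∨ orderOf (lift B ε ν η hη) = 2 * orderOf ν := by
  have hact := actsAs_lift ν η hη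
  have hdvd : orderOf ν ∣ orderOf (lift B ε ν η hη) := by
    rw [← Subgroup.orderOf_coe ν]
    exact hact.orderOf_dvd
  have hdvd2 : orderOf (lift B ε ν η hη) ∣ orderOf ν * 2 := by
    refine orderOf_dvd_of_pow_eq_one ?_
    rw [pow_mul]
    refine ((hact.pow _).pow 2).eq_one_iff.2 ⟨by rw [pow_orderOf_coe, one_pow], fun α => ?_⟩
    simp only [pow_orderOf_coe, one_pow, LinearEquiv.coe_one, id_eq, Finset.prod_const,
      Finset.card_range]
    rw [← Int.cast_prod, ← Units.coe_prod, ← Int.cast_pow, ← Units.val_pow_eq_pow_val,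
      Int.units_sq]
    simp
  obtain ⟨k, hk⟩ := hdvd
  rw [hk] at hdvd2 ⊢
  have hk2 : k ∣ 2 := Nat.dvd_of_mul_dvd_mul_left hν hdvd2
  rcases (Nat.dvd_prime Nat.prime_two).1 hk2 with rfl | rfl
  · exact Or.inl (mul_one _)
  · exact Or.inr (mul_comm _ _)

/-- As ⟨h, ν^i α⟩ does not depend on i, the scalars of the inner factor multiply to e^{-2πi m⟨h, α⟩}
over a full orbit. This factor has to cancel the sign of the m-th power of the lift. -/
lemma orderOf_lift_mul_innerAut_eq_iff (hη : IsLift ε (ν : L ≃ₗ[ℤ] L) η) {h : Cartan L}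
    (hh : h ∈ fixedCartan (ν : L ≃ₗ[ℤ] L)) :
    orderOf (lift B ε ν η hη * innerAut B ε h) = orderOf ν ↔
      ∀ α, ((liftSign (ν : L ≃ₗ[ℤ] L) η (orderOf ν) α : ℤ) : ℂ) =
        Complex.exp (2 * Real.pi * Complex.I * (orderOf ν * formC B h (toCartan α))) := by
  have hact := (actsAs_lift ν η hη).mul (actsAs_innerAut (ε := ε) h)
  rw [mul_one] at hact
  have hinv (i : ℕ) (α : L) :
      formC B h (toCartan (((ν : L ≃ₗ[ℤ] L) ^ i) α)) = formC B h (toCartan α) := by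
    induction i with
    | zero => rw [pow_zero, LinearEquiv.coe_one, id_eq]
    | succ i ih => rw [pow_succ_apply, formC_fixed ν.2 hh, ih]
  rw [← Subgroup.orderOf_coe ν, hact.orderOf_eq_iff]
  refine forall_congr' fun α => ?_
  simp only [hinv, Finset.prod_mul_distrib, Finset.prod_const, Finset.card_range,
    LinearEquiv.coe_one, id_eq, Complex.exp_neg, inv_pow, ← Complex.exp_nat_mul]
  rw [inv_mul_eq_one₀ (Complex.exp_ne_zero _), liftSign, Units.coe_prod, Int.cast_prod, eq_comm,
    mul_left_comm]

lemma exp_two_pi_I_mul_eq_one_iff (z : ℂ) :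
    Complex.exp (2 * Real.pi * Complex.I * z) = 1 ↔ ∃ k : ℤ, z = k := by
  rw [Complex.exp_eq_one_iff]
  refine exists_congr fun k => ?_
  rw [mul_comm, mul_left_inj' Complex.two_pi_I_ne_zero]

/-- The elements of `1/m (L')^ν` are the elements of `𝔥^ν` whose products with `m L` are
integral. -/
lemma mem_inv_smul_dualFixed_iff (hsymm : ∀ α β, B α β = B β α)
    (hpos : ∀ α, α ≠ 0 → 0 < B α α) (ν : L ≃ₗ[ℤ] L) {m : ℂ} (hm : m ≠ 0) {h : Cartan L} :
    h ∈ m⁻¹ • dualFixed B ν ↔ h ∈ fixedCartan ν ∧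
      ∀ β, Complex.exp (2 * Real.pi * Complex.I * (m * formC B h (toCartan β))) = 1 := by
  rw [Set.mem_inv_smul_set_iff₀ hm, mem_dualFixed_iff hsymm hpos,
    Submodule.smul_mem_iff _ hm]
  simp only [exp_two_pi_I_mul_eq_one_iff, map_smul, LinearMap.smul_apply, smul_eq_mul]

end Main

end LatticeVOA

/-! ### Orders m and 2m: the main theorem -/

theorem mainTheorem12 {L : Type*} [AddCommGroup L] [Module.Free ℤ L] [Module.Finite ℤ L]
    (B : LinearMap.BilinForm ℤ L) (hsymm : ∀ α β, B α β = B β α)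
    (hpos : ∀ α, α ≠ 0 → 0 < B α α) (heven : ∀ α, Even (B α α))
    (ε : L → L → ℤˣ) (hε : LatticeVOA.IsLatticeCocycle B ε)
    (ν : LatticeVOA.isometryGroup B) (m : ℕ) (hm : orderOf ν = m)
    (νhat : LatticeVOA.Aut B ε) (hνhat : LatticeVOA.IsStandardLift B ε ν νhat) :
    (orderOf νhat = m ∨ orderOf νhat = 2 * m) ∧
    (orderOf νhat = m →
      ∀ h ∈ LatticeVOA.fixedCartan (ν : L ≃ₗ[ℤ] L),
        (orderOf (νhat * LatticeVOA.innerAut B ε h) = m ↔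
          h ∈ (m : ℂ)⁻¹ • LatticeVOA.dualFixed B (ν : L ≃ₗ[ℤ] L))) ∧
    (orderOf νhat = 2 * m →
      (∃ s ∈ (2 * m : ℂ)⁻¹ • LatticeVOA.dualFixed B (ν : L ≃ₗ[ℤ] L),
        orderOf (LatticeVOA.innerAut B ε s) = 2 * m ∧
        orderOf (νhat * LatticeVOA.innerAut B ε s) = m) ∧
      ∀ s ∈ (2 * m : ℂ)⁻¹ • LatticeVOA.dualFixed B (ν : L ≃ₗ[ℤ] L),
        orderOf (νhat * LatticeVOA.innerAut B ε s) = m →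
        ∀ h ∈ LatticeVOA.fixedCartan (ν : L ≃ₗ[ℤ] L),
          (orderOf (νhat * LatticeVOA.innerAut B ε h) = m ↔
            h ∈ s +ᵥ ((m : ℂ)⁻¹ • LatticeVOA.dualFixed B (ν : L ≃ₗ[ℤ] L)))) := by
  open LatticeVOA in
  obtain ⟨η, hη, hst, rfl⟩ := hνhat
  subst hm
  -- Finiteness guarantees m > 0: `orderOf` would be 0 for an isometry of infinite order, and the
  -- factors 1/m and 1/(2m) would lose their meaning.
  have : Finite (isometryGroup B) := finite_isometryGroup hsymm hpos
  have hm0 : 0 < orderOf ν := orderOf_pos ν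
  have hmC : (orderOf ν : ℂ) ≠ 0 := by exact_mod_cast hm0.ne'
  have h2mC : (2 * orderOf ν : ℂ) ≠ 0 := mul_ne_zero two_ne_zero hmC
  refine ⟨orderOf_lift hm0 hη, fun h1 h hh => ?_, fun h2 => ⟨?_, fun s hs hsm h hh => ?_⟩⟩
  · rw [orderOf_lift_eq_iff] at h1
    rw [orderOf_lift_mul_innerAut_eq_iff hη hh, mem_inv_smul_dualFixed_iff hsymm hpos _ hmC,
      and_iff_right hh]
    refine forall_congr' fun α => ?_
    rw [h1, Units.val_one, Int.cast_one, eq_comm]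
  · have hne : ∃ α, liftSign (ν : L ≃ₗ[ℤ] L) η (orderOf ν) α ≠ 1 := by
      by_contra! hall
      have := (orderOf_lift_eq_iff hη).2 hall
      omega
    obtain ⟨f, hfν, hfsign, hf1⟩ := exists_linearForm hε hη hst (pow_orderOf_coe ν)
    obtain ⟨α₁, hα₁⟩ := hf1 hne
    obtain ⟨x, hx, hxf⟩ := exists_dualFixed hsymm hpos ν.2 f hfν
    -- The solution is s = x/(2m), where x represents f: then m⟨s, α⟩ = f(α)/2, whose exponential is
    -- (-1)^{f(α)}.
    have hs : (2 * orderOf ν : ℂ)⁻¹ • x ∈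
        (2 * orderOf ν : ℂ)⁻¹ • dualFixed B (ν : L ≃ₗ[ℤ] L) := Set.smul_mem_smul_set hx
    have hsf (α : L) : formC B ((2 * orderOf ν : ℂ)⁻¹ • x) (toCartan α) =
        (2 * orderOf ν : ℂ)⁻¹ * f α := by
      rw [map_smul, LinearMap.smul_apply, smul_eq_mul, hxf]
    refine ⟨_, hs, ?_, ?_⟩
    -- The k-th power is trivial if and only if k f(α)/(2m) is an integer for all α. The vector
    -- `α₁`, where f is 1, forces 2m to divide k.
    · have key (k : ℕ) : innerAut B ε ((2 * orderOf ν : ℂ)⁻¹ • x) ^ k = 1 ↔ 2 * orderOf ν ∣ k := by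
        rw [((actsAs_innerAut _).pow k).eq_one_iff, and_iff_right (one_pow k)]
        simp only [one_pow, LinearEquiv.coe_one, id_eq, Finset.prod_const, Finset.card_range,
          Complex.exp_neg, inv_pow, inv_eq_one, ← Complex.exp_nat_mul, hsf]
        simp only [mul_left_comm (k : ℂ), exp_two_pi_I_mul_eq_one_iff]
        constructor
        · intro h
          obtain ⟨j, hj⟩ := h α₁
          rw [hα₁, Int.cast_one, mul_one, inv_mul_eq_iff_eq_mul₀ h2mC] at hj
          rw [← Int.natCast_dvd_natCast]
          exact ⟨j, by exact_mod_cast hj⟩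
        · rintro ⟨j, rfl⟩ α
          refine ⟨j * f α, ?_⟩
          push_cast
          field_simp
      exact Nat.dvd_antisymm (orderOf_dvd_of_pow_eq_one ((key _).2 dvd_rfl))
        ((key _).1 (pow_orderOf_eq_one _))
    · rw [orderOf_lift_mul_innerAut_eq_iff hη
        ((mem_inv_smul_dualFixed_iff hsymm hpos _ h2mC).1 hs).1]
      intro α
      rw [hsf, hfsign]
      have : 2 * (Real.pi : ℂ) * Complex.I * (orderOf ν * ((2 * orderOf ν : ℂ)⁻¹ * f α)) =
          f α * (Real.pi * Complex.I) := by
        field_simp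
      rw [this, Complex.exp_int_mul, Complex.exp_pi_mul_I]
      rcases Int.even_or_odd (f α) with h | h
      · simp [h.neg_one_zpow]
      · simp [h.neg_one_zpow]
  · have hs' := ((mem_inv_smul_dualFixed_iff hsymm hpos _ h2mC).1 hs).1
    rw [orderOf_lift_mul_innerAut_eq_iff hη hs'] at hsm
    -- Solutions form a coset: substituting the condition on s for the sign turns the condition on h
    -- into e^{2πi m⟨h - s, α⟩} = 1.
    rw [orderOf_lift_mul_innerAut_eq_iff hη hh, Set.mem_vadd_set_iff_neg_vadd_mem,
      mem_inv_smul_dualFixed_iff hsymm hpos _ hmC, vadd_eq_add, neg_add_eq_sub,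
      and_iff_right (Submodule.sub_mem _ hh hs')]
    refine forall_congr' fun α => ?_
    rw [hsm, map_sub, LinearMap.sub_apply, mul_sub, mul_sub, Complex.exp_sub,
      div_eq_one_iff_eq (Complex.exp_ne_zero _), eq_comm]
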